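/- Let $l^2$ be the complex Hilbert space of square-summable sequences $\mathbf a=(a_n)_{n\in\mathbb Z}$ with inner product $\langle \mathbf a,\mathbf b\rangle=\sum_n a_n\overline{b_n}$. Let $\widetilde H$ be the discrete Hilbert transform, $(\widetilde H\mathbf a)_m=\frac1\pi\sum_{n\ne m}\frac{a_n}{m-n}$, which is a bounded operator on $l^2$, and let $H=\pi\widetilde H$ and $e^{tH}=\sum_{k\ge 0}\frac{t^k}{k!}H^k$. For $\mathbf a,\mathbf a^*\in l^2$ define $\Psi:\mathbb R\to\mathbb C$ by $$\Psi(t)=\Big\langle \frac{e^{tH}\mathbf a-\mathbf a}{t},\mathbf a^*\Big\rangle\quad(t\neq 0),\qquad \Psi(0)=\langle H\mathbf a,\mathbf a^*\rangle .$$ Let $(t_k)_{k\in\mathbb Z}$ be real numbers with $\sup_{k\in\mathbb Z}|t_k-k|<\tfrac14$, and let $$G(z)=(z-t_0)\prod_{k=1}^\infty\Big(1-\frac{z}{t_k}\Big)\Big(1-\frac{z}{t_{-k}}\Big),\qquad z\in\mathbb C .$$ Then the product converges for every $z\in\mathbb C$, $G$ is an entire function whose zeros are exactly the $t_k$, $k\in\mathbb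 Z$, all of them simple, and $$\Psi(t)=\sum_{k\in\mathbb Z}\Psi(t_k)\,\frac{G(t)}{G'(t_k)(t-t_k)},$$ where the $k$-th quotient is given its limit value $1$ at $t=t_k$, and where the series converges (unconditionally, i.e. along the net of finite subsets of $\mathbb Z$) uniformly on every compact subset of $\mathbb R$. -/

import Mathlib

open scoped ENNReal

noncomputable section

namespace DiscreteHilbert

/-- The complex Hilbert space `l²` of square-summable sequences indexed by `ℤ`. -/
abbrev L2Z : Type := lp (fun _ : ℤ => ℂ) 2

/-- The entry `b_m = (1/π) ∑_{n ≠ m} a_n / (m - n)` of the discrete Hilbert transform of `a`. -/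
def hilbertEntry (a : ℤ → ℂ) (m : ℤ) : ℂ :=
  (1 / (Real.pi : ℂ)) * ∑' n : ℤ, if n = m then 0 else a n / ((m : ℂ) - (n : ℂ))

section Boundedness

/- The discrete Hilbert transform is well defined and bounded on `l²`: on the Fourier side it is
multiplication by a bounded sawtooth function. -/

open MeasureTheory AddCircle

/-- The sawtooth function whose Fourier coefficients are `1 / (π n)` for `n ≠ 0`, and `0` at `0`. -/
def sawtooth (x : UnitAddCircle) : ℂ :=
  (-(2 * Complex.I)) * (periodizedBernoulli 1 x : ℂ)

lemma fourierCoeff_sawtooth (n : ℤ) :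
    fourierCoeff sawtooth n = (1 / (Real.pi : ℂ)) * (1 / (n : ℂ)) := by
  have h := fourierCoeff_bernoulli_eq (k := 1) one_ne_zero n
  have h2 := fourierCoeff.const_mul (T := 1)
    ((fun x : ℝ => (x : ℂ)) ∘ periodizedBernoulli 1) (-(2 * Complex.I)) n
  have h3 : fourierCoeff sawtooth n = (-(2 * Complex.I)) *
      (-(Nat.factorial 1 : ℕ) / (2 * Real.pi * Complex.I * n) ^ 1) := by
    rw [← h]; exact h2
  rw [h3]
  have hpi : (Real.pi : ℂ) ≠ 0 := by exact_mod_cast Real.pi_ne_zero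
  by_cases hn : (n : ℂ) = 0
  · simp [hn]
  · have hI := Complex.I_ne_zero
    simp only [Nat.factorial_one, Nat.cast_one, pow_one]
    field_simp

lemma measurable_sawtooth : Measurable sawtooth := by
  have h1 : Measurable (periodizedBernoulli 1) := by
    have : Measurable (bernoulliFun 1) := (Polynomial.continuous _).measurable
    exact (this.comp measurable_subtype_coe).comp (AddCircle.measurableEquivIco 1 0).measurable
  exact (Complex.measurable_ofReal.comp h1).const_mul _

lemma norm_sawtooth_le (x : UnitAddCircle) : ‖sawtooth x‖ ≤ 1 := by
  have hx := (AddCircle.equivIco (1 : ℝ) 0 x).2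
  have h : periodizedBernoulli 1 x = (AddCircle.equivIco (1 : ℝ) 0 x : ℝ) - 1 / 2 := by
    change bernoulliFun 1 _ = _
    simp [bernoulliFun, Polynomial.bernoulli_one]
  have h2 : |periodizedBernoulli 1 x| ≤ 1 / 2 := by
    rw [h, abs_le]
    have := hx.1
    have := hx.2
    constructor <;> linarith
  rw [sawtooth, norm_mul, Complex.norm_real, Real.norm_eq_abs]
  simp only [norm_neg, norm_mul, Complex.norm_I, Complex.norm_ofNat]
  linarith

lemma memLp_sawtooth : MemLp sawtooth ∞ (haarAddCircle (T := 1)) :=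
  memLp_top_of_bound measurable_sawtooth.aestronglyMeasurable 1
    (Filter.Eventually.of_forall norm_sawtooth_le)

/-- The discrete Hilbert transform as a Fourier multiplier; only used to prove boundedness. -/
def multiplier : L2Z →L[ℂ] L2Z :=
  ((fourierBasis (T := 1)).repr.toContinuousLinearEquiv : _ →L[ℂ] L2Z) ∘L
    ((ContinuousLinearMap.mul ℂ ℂ).holderL (haarAddCircle (T := 1)) ∞ 2 2
      (memLp_sawtooth.toLp sawtooth)) ∘L
    ((fourierBasis (T := 1)).repr.symm.toContinuousLinearEquiv : L2Z →L[ℂ] _)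

lemma multiplier_single (n m : ℤ) (c : ℂ) :
    multiplier (lp.single 2 n c) m =
      (1 / (Real.pi : ℂ)) * (if n = m then 0 else c / ((m : ℂ) - (n : ℂ))) := by
  have e : lp.single 2 n c = c • (lp.single 2 n (1 : ℂ) : L2Z) := by
    rw [← lp.single_smul]; simp
  have key : multiplier (lp.single 2 n (1 : ℂ)) m = fourierCoeff sawtooth (m - n) := by
    have e1 : multiplier (lp.single 2 n (1 : ℂ)) = (fourierBasis (T := 1)).repr
        ((ContinuousLinearMap.mul ℂ ℂ).holder 2 (memLp_sawtooth.toLp sawtooth)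
          ((fourierBasis (T := 1)).repr.symm (lp.single 2 n (1 : ℂ)))) := rfl
    rw [e1, fourierBasis_repr, HilbertBasis.repr_symm_single, coe_fourierBasis]
    unfold fourierCoeff
    refine integral_congr_ae ?_
    filter_upwards [(ContinuousLinearMap.mul ℂ ℂ).coeFn_holder (r := 2)
      (memLp_sawtooth.toLp sawtooth) (fourierLp (T := 1) 2 n),
      memLp_sawtooth.coeFn_toLp, coeFn_fourierLp (T := 1) 2 n] with x h1 h2 h3
    rw [h1, h2, h3]
    rw [show -(m - n) = -m + n by ring, fourier_add]
    simp only [ContinuousLinearMap.mul_apply', smul_eq_mul]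
    ring
  rw [e, map_smul, lp.coeFn_smul, Pi.smul_apply, key, fourierCoeff_sawtooth]
  by_cases h : n = m
  · simp [h]
  · rw [if_neg h]; push_cast; simp only [smul_eq_mul]; ring

lemma hasSum_multiplier (a : L2Z) (m : ℤ) :
    HasSum (fun n : ℤ => (1 / (Real.pi : ℂ)) * (if n = m then 0 else a n / ((m : ℂ) - (n : ℂ))))
      (multiplier a m) := by
  have h := lp.hasSum_single (p := 2) (by simp) a
  have h2 := h.mapL (((lp.evalCLM ℂ (fun _ : ℤ => ℂ) 2 m)) ∘L multiplier)
  convert! h2 using 2 with n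
  exact (multiplier_single n m (a n)).symm

end Boundedness

lemma multiplier_apply (a : L2Z) (m : ℤ) : multiplier a m = hilbertEntry a m := by
  rw [hilbertEntry, ← tsum_mul_left, (hasSum_multiplier a m).tsum_eq]

/-- The discrete Hilbert transform `b_m = (1/π) ∑_{n ≠ m} a_n / (m - n)` as a bounded operator
on `l²`. -/
def discreteHilbertTransform : L2Z →L[ℂ] L2Z where
  toFun a := ⟨hilbertEntry a, by
    have h : hilbertEntry a = (multiplier a : ℤ → ℂ) := by
      ext m; exact (multiplier_apply a m).symm
    rw [h]; exact lp.memℓp (multiplier a)⟩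
  map_add' a b := by
    ext m
    change hilbertEntry (a + b : L2Z) m = hilbertEntry a m + hilbertEntry b m
    rw [← multiplier_apply, ← multiplier_apply, ← multiplier_apply, map_add]
    rfl
  map_smul' c a := by
    ext m
    change hilbertEntry (c • a : L2Z) m = c * hilbertEntry a m
    rw [← multiplier_apply, ← multiplier_apply, map_smul]
    rfl
  cont := by
    refine multiplier.continuous.congr fun a => ?_
    ext m
    exact multiplier_apply a m

/-- The operator `H = π H̃`. -/
def H : L2Z →L[ℂ] L2Z := (Real.pi : ℂ) • discreteHilbertTransform

/-- The inner product `⟨x, y⟩ = ∑ x_n conj(y_n)`, linear in the first variable. -/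
def pairing (x y : L2Z) : ℂ := inner ℂ y x

/-- `Ψ(t) = ⟨(e^{tH} a - a) / t, a*⟩` for `t ≠ 0`, and `Ψ(0) = ⟨H a, a*⟩`. -/
def Psi (a aStar : L2Z) (t : ℝ) : ℂ :=
  if t = 0 then pairing (H a) aStar
  else pairing ((t : ℂ)⁻¹ • (NormedSpace.exp ((t : ℂ) • H) a - a)) aStar

/-- The `k`-th factor, `k ≥ 1`, of the canonical product. -/
def pairFactor (τ : ℤ → ℝ) (k : ℕ) (z : ℂ) : ℂ :=
  (1 - z / (τ (k : ℤ) : ℂ)) * (1 - z / (τ (-(k : ℤ)) : ℂ))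

/-- `G(z) = (z - t_0) ∏_{k ≥ 1} (1 - z / t_k) (1 - z / t_{-k})`. -/
def G (τ : ℤ → ℝ) (z : ℂ) : ℂ :=
  (z - (τ 0 : ℂ)) * ∏' k : ℕ, pairFactor τ (k + 1) z

/-- The sampling function `G(t) / (G'(t_k) (t - t_k))`, with its limit `1` at `t = t_k`. -/
def samplingKernel (τ : ℤ → ℝ) (k : ℤ) (t : ℝ) : ℂ :=
  if t = τ k then 1
  else G τ (t : ℂ) / (deriv (G τ) (τ k : ℂ) * ((t : ℂ) - (τ k : ℂ)))

end DiscreteHilbert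

end

/-
The function `Ψ` is a bounded linear functional of the exponential `u ↦ exp (-2πitu)` in
`L²(-1/2, 1/2)`: on the Fourier side `H` is multiplication by `-2πiu`, and the quotient
`(exp (-2πitu) - 1) / t` is `-2πi` times the integral of `exp (-2πitv)` over `0 ≤ v ≤ u`. By
Kadec's `1/4` theorem the exponentials of frequencies `t_k` are the image of the standard basis of
`l²` under a Banach isomorphism, so it suffices to expand the exponential of frequency `t` in that
basis. To recognise its `k`-th coordinate as `G(t) / (G'(t_k) (t - t_k))`, replace all but finitely
many of the `t_k` by the integers `k`; there Lagrange interpolation gives the coordinate up to a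
constant factor, which is fixed in the limit by the value `1` at `t_k`.
-/

noncomputable section

namespace DiscreteHilbert

open MeasureTheory Filter Topology

section Multiplication

variable {α 𝕜 : Type*} [RCLike 𝕜] {_ : MeasurableSpace α} {μ : Measure α} {p : ℝ≥0∞}
  [Fact (1 ≤ p)]

/-- Multiplication by an essentially bounded function, as a bounded operator on `Lᵖ`. -/
def mulOp (p : ℝ≥0∞) [Fact (1 ≤ p)] {m : α → 𝕜} (hm : MemLp m ∞ μ) : Lp 𝕜 p μ →L[𝕜] Lp 𝕜 p μ :=
  (ContinuousLinearMap.mul 𝕜 𝕜).holderL μ ∞ p p (hm.toLp m)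

lemma coeFn_mulOp {m : α → 𝕜} (hm : MemLp m ∞ μ) (f : Lp 𝕜 p μ) :
    mulOp p hm f =ᵐ[μ] fun x => m x * f x := by
  filter_upwards [(ContinuousLinearMap.mul 𝕜 𝕜).coeFn_holder (r := p) (hm.toLp m) f,
    hm.coeFn_toLp] with x hmul hcoe
  change ((ContinuousLinearMap.mul 𝕜 𝕜).holder p (hm.toLp m) f : α → 𝕜) x = _
  rw [hmul, hcoe, ContinuousLinearMap.mul_apply']

lemma norm_mulOp_le {m : α → 𝕜} (hm : MemLp m ∞ μ) {C : ℝ} (hC : 0 ≤ C)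
    (hb : ∀ᵐ x ∂μ, ‖m x‖ ≤ C) : ‖mulOp p hm‖ ≤ C := by
  refine ContinuousLinearMap.opNorm_le_bound _ hC fun f => ?_
  refine Lp.norm_le_mul_norm_of_ae_le_mul ?_
  filter_upwards [coeFn_mulOp hm f, hb] with x hx hmx
  rw [hx, norm_mul]
  gcongr

lemma smul_mulOp {m : α → 𝕜} (hm : MemLp m ∞ μ) (c : 𝕜) :
    c • mulOp p hm = mulOp p (hm.const_smul c) := by
  rw [mulOp, mulOp, MemLp.toLp_const_smul, map_smul]

lemma coeFn_mulOp_pow {m : α → 𝕜} (hm : MemLp m ∞ μ) (n : ℕ) (f : Lp 𝕜 p μ) :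
    (mulOp p hm ^ n) f =ᵐ[μ] fun x => m x ^ n * f x := by
  induction n with
  | zero => simp
  | succ n ih =>
    rw [pow_succ', mul_apply_eq_comp]
    filter_upwards [ih, coeFn_mulOp hm ((mulOp p hm ^ n) f)] with x hpow hmul
    rw [hmul, hpow, pow_succ', mul_assoc]

lemma ae_eq_of_tendsto_Lp {E : Type*} [NormedAddCommGroup E] {F : ℕ → Lp E p μ} {f : Lp E p μ}
    {g : α → E} (hF : Tendsto F atTop (𝓝 f))
    (hg : ∀ᵐ x ∂μ, Tendsto (fun n => F n x) atTop (𝓝 (g x))) : f =ᵐ[μ] g := by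
  obtain ⟨φ, hφ, hφf⟩ := (tendstoInMeasure_of_tendsto_Lp hF).exists_seq_tendsto_ae
  filter_upwards [hφf, hg] with x hf hg
  exact tendsto_nhds_unique hf (hg.comp hφ.tendsto_atTop)

lemma coeFn_exp_mulOp {m : α → 𝕜} (hm : MemLp m ∞ μ) (f : Lp 𝕜 p μ) :
    NormedSpace.exp (mulOp p hm) f =ᵐ[μ] fun x => NormedSpace.exp (m x) * f x := by
  have hseries := ((NormedSpace.exp_series_hasSum_exp' (𝕂 := 𝕜) (mulOp p hm)).mapL
    (ContinuousLinearMap.apply 𝕜 _ f)).tendsto_sum_nat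
  refine ae_eq_of_tendsto_Lp hseries ?_
  have hterm : ∀ᵐ x ∂μ, ∀ n : ℕ, ((n.factorial : 𝕜)⁻¹ • (mulOp p hm ^ n) f : Lp 𝕜 p μ) x =
      (n.factorial : 𝕜)⁻¹ • m x ^ n * f x := by
    refine ae_all_iff.2 fun n => ?_
    filter_upwards [Lp.coeFn_smul (n.factorial : 𝕜)⁻¹ ((mulOp p hm ^ n) f),
      coeFn_mulOp_pow hm n f] with x hsmul hpow
    rw [hsmul, Pi.smul_apply, hpow, smul_mul_assoc]
  have hsum : ∀ᵐ x ∂μ, ∀ N : ℕ,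
      (∑ n ∈ Finset.range N, ((n.factorial : 𝕜)⁻¹ • (mulOp p hm ^ n) f) : Lp 𝕜 p μ) x =
        ∑ n ∈ Finset.range N, ((n.factorial : 𝕜)⁻¹ • (mulOp p hm ^ n) f : Lp 𝕜 p μ) x :=
    ae_all_iff.2 fun N => by
      filter_upwards [Lp.coeFn_finsetSum (Finset.range N)
        fun n => (n.factorial : 𝕜)⁻¹ • (mulOp p hm ^ n) f] with x hx
      rw [hx, Finset.sum_apply]
  filter_upwards [hterm, hsum] with x hterm hsum
  refine ((NormedSpace.exp_series_hasSum_exp' (𝕂 := 𝕜) (m x)).mul_right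
    (f x)).tendsto_sum_nat.congr fun N => ?_
  rw [← Finset.sum_congr rfl fun n _ => hterm n, ← hsum N]
  rfl

end Multiplication

section ExponentialSystem

open AddCircle

/-- The Hilbert space of square-integrable functions on the circle. -/
abbrev L2Circle : Type := Lp ℂ 2 (haarAddCircle (T := 1))

/-- The coordinate with values in `[-1/2, 1/2)` on the circle cut at `0`, the point where
`sawtooth` jumps. -/
def centre (x : UnitAddCircle) : ℝ := periodizedBernoulli 1 x

lemma centre_eq (x : UnitAddCircle) :
    centre x = (AddCircle.equivIco (1 : ℝ) 0 x : ℝ) - 1 / 2 := by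
  change bernoulliFun 1 _ = _
  simp [bernoulliFun, Polynomial.bernoulli_one]

lemma centre_coe {x : ℝ} (hx : x ∈ Set.Ico (0 : ℝ) 1) :
    centre (x : UnitAddCircle) = x - 1 / 2 := by
  rw [centre_eq, AddCircle.coe_equivIco_mk_apply, div_one, mul_one, Int.fract_eq_self.2 hx]

lemma abs_centre_le (x : UnitAddCircle) : |centre x| ≤ 1 / 2 := by
  obtain ⟨h0, h1⟩ := (AddCircle.equivIco (1 : ℝ) 0 x).2
  rw [centre_eq, abs_le]
  constructor <;> linarith

lemma measurable_centre : Measurable centre := by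
  have : Measurable (bernoulliFun 1) := (Polynomial.continuous _).measurable
  exact (this.comp measurable_subtype_coe).comp (AddCircle.measurableEquivIco 1 0).measurable

lemma measurePreserving_centre : MeasurePreserving centre haarAddCircle
    (volume.restrict (Set.Ioc (-(1 / 2)) (1 / 2))) := by
  have hvol : (haarAddCircle (T := 1)) = volume := by simp [volume_eq_smul_haarAddCircle]
  have hshift : MeasurePreserving (fun x : ℝ => x - 1 / 2) (volume.restrict (Set.Ioc 0 1))
      (volume.restrict (Set.Ioc (-(1 / 2)) (1 / 2))) := by
    convert! (measurePreserving_sub_right volume (1 / 2 : ℝ)).restrict_preimage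
      (measurableSet_Ioc (a := (-(1 / 2) : ℝ)) (b := 1 / 2)) using 2
    rw [Set.preimage_sub_const_Ioc]
    norm_num
  have hmk := UnitAddCircle.measurePreserving_mk 0
  rw [zero_add, ← hvol] at hmk
  refine ⟨measurable_centre, ?_⟩
  rw [← hmk.map_eq, Measure.map_map measurable_centre hmk.measurable, ← hshift.map_eq]
  refine Measure.map_congr ?_
  have hne : ∀ᵐ x : ℝ, x ≠ 1 := by simp [ae_iff]
  filter_upwards [ae_restrict_mem measurableSet_Ioc, ae_restrict_of_ae hne] with x hx hx1
  exact centre_coe ⟨hx.1.le, lt_of_le_of_ne hx.2 hx1⟩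

/-- The character `u ↦ exp (-2πi t u)` of the line. -/
def expLine (t u : ℝ) : ℂ := Complex.exp ((-(2 * Real.pi * t) * u : ℝ) * Complex.I)

lemma continuous_expLine (t : ℝ) : Continuous (expLine t) := by
  unfold expLine
  fun_prop

lemma norm_expLine (t u : ℝ) : ‖expLine t u‖ = 1 :=
  Complex.norm_exp_ofReal_mul_I _

lemma expLine_add (s t u : ℝ) : expLine (s + t) u = expLine s u * expLine t u := by
  rw [expLine, expLine, expLine, ← Complex.exp_add]
  push_cast
  ring_nf

lemma conj_expLine (t u : ℝ) : (starRingEnd ℂ) (expLine t u) = expLine (-t) u := by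
  rw [expLine, expLine, ← Complex.exp_conj, map_mul, Complex.conj_ofReal, Complex.conj_I]
  push_cast
  ring_nf

/-- The exponential of frequency `t` on the circle, in the coordinate `centre`; it is discontinuous
unless `t` is an integer. -/
def expFun (t : ℝ) (x : UnitAddCircle) : ℂ := expLine t (centre x)

lemma norm_expFun (t : ℝ) (x : UnitAddCircle) : ‖expFun t x‖ = 1 :=
  norm_expLine t _

lemma measurable_expFun (t : ℝ) : Measurable (expFun t) :=
  (continuous_expLine t).measurable.comp measurable_centre

lemma memLp_expFun (p : ℝ≥0∞) (t : ℝ) : MemLp (expFun t) p (haarAddCircle (T := 1)) :=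
  MemLp.of_bound (measurable_expFun t).aestronglyMeasurable 1
    (Eventually.of_forall fun x => (norm_expFun t x).le)

/-- The function `expFun t` as a vector of `L²`. -/
def expVec (t : ℝ) : L2Circle := (memLp_expFun 2 t).toLp (expFun t)

lemma coeFn_expVec (t : ℝ) : expVec t =ᵐ[haarAddCircle] expFun t := (memLp_expFun 2 t).coeFn_toLp

/-- Multiplication by `expFun s`, which shifts frequencies by `s`. -/
def modulation (s : ℝ) : L2Circle →L[ℂ] L2Circle := mulOp 2 (memLp_expFun ∞ s)

lemma coeFn_modulation (s : ℝ) (f : L2Circle) :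
    modulation s f =ᵐ[haarAddCircle] fun x => expFun s x * f x :=
  coeFn_mulOp _ f

lemma norm_modulation_le (s : ℝ) : ‖modulation s‖ ≤ 1 :=
  norm_mulOp_le _ zero_le_one (Eventually.of_forall fun x => (norm_expFun s x).le)

lemma modulation_expVec (s t : ℝ) : modulation s (expVec t) = expVec (s + t) := by
  refine Lp.ext ?_
  filter_upwards [coeFn_modulation s (expVec t), coeFn_expVec t, coeFn_expVec (s + t)]
    with x hmod ht hst
  rw [hmod, ht, hst, expFun, expFun, expFun, expLine_add]

lemma integral_expFun (t : ℝ) :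
    ∫ x : UnitAddCircle, expFun t x ∂haarAddCircle = (Real.sinc (Real.pi * t) : ℂ) := by
  have hcentre : ∫ x : UnitAddCircle, expFun t x ∂haarAddCircle =
      ∫ u in (-(1 / 2) : ℝ)..(1 / 2), expLine t u := by
    rw [intervalIntegral.integral_of_le (by norm_num), ← measurePreserving_centre.map_eq,
      integral_map measurable_centre.aemeasurable (continuous_expLine t).aestronglyMeasurable]
    rfl
  rw [hcentre]
  rcases eq_or_ne t 0 with rfl | ht
  · norm_num [expLine]
  have hscale := intervalIntegral.integral_comp_mul_left (a := -(1 / 2)) (b := 1 / 2)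
    (fun v : ℝ => Complex.exp (v * Complex.I)) (c := -(2 * Real.pi * t))
    (by simpa [Real.pi_ne_zero] using ht)
  have hleft : -(2 * Real.pi * t) * -(1 / 2) = - -(Real.pi * t) := by ring
  have hright : -(2 * Real.pi * t) * (1 / 2) = -(Real.pi * t) := by ring
  rw [hleft, hright, integral_exp_mul_I_eq_sinc, Real.sinc_neg, Complex.real_smul] at hscale
  refine hscale.trans ?_
  have ht' : (t : ℂ) ≠ 0 := Complex.ofReal_ne_zero.2 ht
  have hpi : (Real.pi : ℂ) ≠ 0 := Complex.ofReal_ne_zero.2 Real.pi_ne_zero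
  push_cast
  field_simp

lemma inner_expVec (s t : ℝ) :
    inner ℂ (expVec s) (expVec t) = (Real.sinc (Real.pi * (t - s)) : ℂ) := by
  rw [L2.inner_def, ← integral_expFun]
  refine integral_congr_ae ?_
  filter_upwards [coeFn_expVec s, coeFn_expVec t] with x hs ht
  rw [hs, ht, sub_eq_neg_add, expFun, expFun, expFun, expLine_add, ← conj_expLine, mul_comm]
  rfl

lemma norm_expVec_sub_sq (s t : ℝ) :
    ‖expVec s - expVec t‖ ^ 2 = 2 - 2 * Real.sinc (Real.pi * (t - s)) := by
  have hnorm (r : ℝ) : ‖expVec r‖ ^ 2 = 1 := by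
    rw [@norm_sq_eq_re_inner ℂ, inner_expVec, sub_self, mul_zero, Real.sinc_zero]
    simp
  rw [@norm_sub_sq ℂ, hnorm, hnorm, inner_expVec, RCLike.re_to_complex, Complex.ofReal_re]
  ring

lemma continuous_expVec : Continuous expVec := by
  refine continuous_iff_continuousAt.2 fun t => tendsto_iff_norm_sub_tendsto_zero.2 ?_
  have hcont : Continuous fun s => √(2 - 2 * Real.sinc (Real.pi * (t - s))) := by
    fun_prop
  have hsqrt (s : ℝ) : √(2 - 2 * Real.sinc (Real.pi * (t - s))) = ‖expVec s - expVec t‖ := by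
    rw [← norm_expVec_sub_sq, Real.sqrt_sq (norm_nonneg _)]
  simpa [hsqrt] using hcont.tendsto t

lemma sinc_pi_mul_intCast (n : ℤ) : Real.sinc (Real.pi * n) = if n = 0 then 1 else 0 := by
  split_ifs with h
  · simp [h]
  · rw [Real.sinc_of_ne_zero (mul_ne_zero Real.pi_ne_zero (Int.cast_ne_zero.2 h)), mul_comm,
      Real.sin_int_mul_pi, zero_div]

lemma orthonormal_expVec : Orthonormal ℂ fun k : ℤ => expVec k := by
  rw [orthonormal_iff_ite]
  intro i j
  rw [inner_expVec, ← Int.cast_sub, sinc_pi_mul_intCast]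
  simp only [sub_eq_zero, eq_comm]
  split_ifs <;> simp

lemma expFun_intCast (k : ℤ) (x : UnitAddCircle) :
    expFun k x = (-1) ^ k * fourier (-k) x := by
  obtain ⟨y, hy, rfl⟩ : ∃ y ∈ Set.Ico (0 : ℝ) 1, (y : UnitAddCircle) = x :=
    ⟨AddCircle.equivIco (1 : ℝ) 0 x, by simpa using (AddCircle.equivIco (1 : ℝ) 0 x).2,
      AddCircle.coe_equivIco⟩
  rw [fourier_coe_apply, expFun, expLine, centre_coe hy, ← Complex.exp_pi_mul_I,
    ← Complex.exp_int_mul, ← Complex.exp_add]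
  congr 1
  push_cast
  ring

lemma expVec_intCast (k : ℤ) : expVec k = (-1 : ℂ) ^ k • fourierLp (T := 1) 2 (-k) := by
  refine Lp.ext ?_
  filter_upwards [coeFn_expVec k, coeFn_fourierLp (T := 1) 2 (-k),
    Lp.coeFn_smul ((-1 : ℂ) ^ k) (fourierLp (T := 1) 2 (-k))] with x hexp hfourier hsmul
  rw [hexp, hsmul, Pi.smul_apply, hfourier, expFun_intCast, smul_eq_mul]

lemma fourierLp_mem_span_expVec (n : ℤ) :
    fourierLp (T := 1) 2 n ∈ Submodule.span ℂ (Set.range fun k : ℤ => expVec k) := by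
  have hexp : expVec (-n : ℤ) = (-1 : ℂ) ^ (-n) • fourierLp (T := 1) 2 n := by
    rw [expVec_intCast, neg_neg]
  rw [← Submodule.smul_mem_iff _ (zpow_ne_zero (-n) (neg_ne_zero.2 (one_ne_zero (α := ℂ)))), ← hexp]
  exact Submodule.subset_span ⟨-n, rfl⟩

/-- The orthonormal basis of integer exponentials. -/
def expBasis : HilbertBasis ℤ ℂ L2Circle :=
  HilbertBasis.mk orthonormal_expVec <| by
    rw [← span_fourierLp_closure_eq_top (T := 1) (p := 2) (by simp)]
    refine Submodule.topologicalClosure_mono (Submodule.span_le.2 ?_)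
    rintro _ ⟨n, rfl⟩
    exact fourierLp_mem_span_expVec n

lemma expBasis_apply (k : ℤ) : expBasis k = expVec k := by
  rw [expBasis, HilbertBasis.coe_mk]

end ExponentialSystem

section Psi

open AddCircle

lemma H_eq_conj_mulOp : H =
    (fourierBasis (T := 1)).repr.toContinuousLinearEquiv.conjContinuousAlgEquiv
      (mulOp 2 (memLp_sawtooth.const_smul (Real.pi : ℂ))) := by
  have hmul : discreteHilbertTransform = multiplier := by
    ext a m
    exact (multiplier_apply a m).symm
  rw [H, hmul, ← smul_mulOp, map_smul]
  rfl

lemma exp_mul_pi_sawtooth (t : ℝ) (x : UnitAddCircle) :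
    NormedSpace.exp ((t : ℂ) • (Real.pi : ℂ) • sawtooth x) = expFun t x := by
  rw [← Complex.exp_eq_exp_ℂ, expFun, expLine, sawtooth, centre]
  simp only [smul_eq_mul]
  push_cast
  ring_nf

lemma exp_smul_H_apply (t : ℝ) (a : L2Z) : NormedSpace.exp ((t : ℂ) • H) a =
    (fourierBasis (T := 1)).repr (modulation t ((fourierBasis (T := 1)).repr.symm a)) := by
  have hmod (f : L2Circle) : NormedSpace.exp (mulOp 2
      ((memLp_sawtooth.const_smul (Real.pi : ℂ)).const_smul (t : ℂ))) f = modulation t f := by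
    refine Lp.ext ?_
    filter_upwards [coeFn_exp_mulOp ((memLp_sawtooth.const_smul (Real.pi : ℂ)).const_smul (t : ℂ))
      f, coeFn_modulation t f] with x hexp hmod
    rw [hexp, hmod, Pi.smul_apply, Pi.smul_apply, exp_mul_pi_sawtooth]
  let _ : NormedAlgebra ℚ (L2Circle →L[ℂ] L2Circle) := .restrictScalars ℚ ℂ _
  rw [H_eq_conj_mulOp, ← map_smul, smul_mulOp, ← NormedSpace.map_exp _ (map_continuous _)]
  exact congrArg _ (hmod _)

/-- The product of the Fourier series of `a` with the conjugate of that of `b`. -/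
def density (a b : L2Z) (x : UnitAddCircle) : ℂ :=
  inner ℂ ((fourierBasis (T := 1)).repr.symm b x) ((fourierBasis (T := 1)).repr.symm a x)

lemma integrable_density (a b : L2Z) : Integrable (density a b) (haarAddCircle (T := 1)) :=
  L2.integrable_inner _ _

lemma pairing_repr_eq_integral {a : L2Z} (b : L2Z) {f : L2Circle} {m : UnitAddCircle → ℂ}
    (hf : f =ᵐ[haarAddCircle] fun x => m x * (fourierBasis (T := 1)).repr.symm a x) :
    pairing ((fourierBasis (T := 1)).repr f) b =
      ∫ x, density a b x * m x ∂haarAddCircle := by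
  rw [pairing, ← (fourierBasis (T := 1)).repr.symm.inner_map_map,
    LinearIsometryEquiv.symm_apply_apply, L2.inner_def]
  refine integral_congr_ae ?_
  filter_upwards [hf] with x hx
  rw [hx, density, ← smul_eq_mul (m x), inner_smul_right, mul_comm]

lemma mul_integral_expLine (t c : ℝ) :
    t * (-(2 * Real.pi * Complex.I) * ∫ u in (0 : ℝ)..c, expLine t u) = expLine t c - 1 := by
  have hderiv (u : ℝ) :
      HasDerivAt (expLine t) (expLine t u * (-(2 * Real.pi * t) * Complex.I)) u := by
    have := (((hasDerivAt_id u).const_mul (-(2 * Real.pi * t))).ofReal_comp.mul_const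
      Complex.I).cexp
    refine this.congr_deriv ?_
    simp [expLine]
  have hint := intervalIntegral.integral_eq_sub_of_hasDerivAt (a := 0) (b := c)
    (fun u _ => hderiv u) (((continuous_expLine t).mul continuous_const).intervalIntegrable _ _)
  rw [intervalIntegral.integral_mul_const] at hint
  have hzero : expLine t 0 = 1 := by simp [expLine]
  rw [← hzero, ← hint]
  ring

lemma Psi_eq_integral (a b : L2Z) (t : ℝ) :
    Psi a b t = ∫ x, density a b x *
      (-(2 * Real.pi * Complex.I) * ∫ u in (0 : ℝ)..centre x, expLine t u) ∂haarAddCircle := by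
  rcases eq_or_ne t 0 with rfl | ht
  · rw [Psi, if_pos rfl, H_eq_conj_mulOp]
    refine pairing_repr_eq_integral b ?_
    filter_upwards [coeFn_mulOp (memLp_sawtooth.const_smul (Real.pi : ℂ))
      ((fourierBasis (T := 1)).repr.symm a)] with x hx
    refine hx.trans ?_
    simp only [Pi.smul_apply, sawtooth, smul_eq_mul, expLine, centre, mul_zero, neg_zero, zero_mul,
      Complex.ofReal_zero, Complex.exp_zero, intervalIntegral.integral_const, sub_zero,
      Complex.real_smul, mul_one]
    ring
  · rw [Psi, if_neg ht, exp_smul_H_apply, ← (fourierBasis (T := 1)).repr.apply_symm_apply a,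
      LinearIsometryEquiv.symm_apply_apply, ← map_sub, ← map_smul]
    refine pairing_repr_eq_integral b ?_
    set f := (fourierBasis (T := 1)).repr.symm a
    filter_upwards [Lp.coeFn_smul (t : ℂ)⁻¹ (modulation t f - f), Lp.coeFn_sub (modulation t f) f,
      coeFn_modulation t f] with x hsmul hsub hmod
    have ht' : (t : ℂ) ≠ 0 := Complex.ofReal_ne_zero.2 ht
    rw [hsmul, Pi.smul_apply, hsub, Pi.sub_apply, hmod, expFun, smul_eq_mul,
      LinearIsometryEquiv.apply_symm_apply, inv_mul_eq_iff_eq_mul₀ ht', ← mul_assoc,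
      mul_integral_expLine, sub_mul, one_mul]

/-- The indicator function of `{x | centre x ≤ c}`, whose inner products with `L²` functions are
their indefinite integrals. -/
def sublevelVec (c : ℝ) : L2Circle :=
  indicatorConstLp 2 (measurable_centre (measurableSet_Iic (a := c))) (measure_ne_top _ _) 1

lemma continuous_sublevelVec : Continuous sublevelVec := by
  refine continuous_indicatorConstLp_set (by simp) fun c => ?_
  have hlim : Tendsto (fun d => ENNReal.ofReal |c - d|) (𝓝 c) (𝓝 0) := by
    have : Continuous fun d : ℝ => ENNReal.ofReal |c - d| :=
      ENNReal.continuous_ofReal.comp (by fun_prop)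
    simpa using this.tendsto c
  refine tendsto_of_tendsto_of_tendsto_of_le_of_le tendsto_const_nhds hlim (fun _ => zero_le)
    fun d => ?_
  have hsub : symmDiff (Set.Iic d) (Set.Iic c) ⊆ Set.uIoc d c := by
    intro u hu
    simpa [Set.mem_symmDiff, Set.mem_uIoc, and_comm, or_comm] using hu
  calc haarAddCircle (symmDiff (centre ⁻¹' Set.Iic d) (centre ⁻¹' Set.Iic c))
      ≤ haarAddCircle (centre ⁻¹' Set.uIoc d c) := measure_mono (Set.preimage_mono hsub)
    _ = volume.restrict (Set.Ioc (-(1 / 2)) (1 / 2)) (Set.uIoc d c) :=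
        measurePreserving_centre.measure_preimage measurableSet_uIoc.nullMeasurableSet
    _ ≤ volume (Set.uIoc d c) := Measure.restrict_apply_le _ _
    _ = ENNReal.ofReal |c - d| := Real.volume_uIoc

lemma norm_sublevelVec_le (c : ℝ) : ‖sublevelVec c‖ ≤ 1 := by
  refine norm_indicatorConstLp_le.trans ?_
  simpa using Real.rpow_le_one measureReal_nonneg measureReal_le_one (by norm_num)

lemma inner_sublevelVec_expVec (t : ℝ) {c : ℝ} (hc : |c| ≤ 1 / 2) :
    inner ℂ (sublevelVec c) (expVec t) = ∫ u in (-(1 / 2) : ℝ)..c, expLine t u := by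
  obtain ⟨hc0, hc1⟩ := abs_le.1 hc
  have hmap := setIntegral_map (μ := haarAddCircle) (measurableSet_Iic (a := c))
    (continuous_expLine t).aestronglyMeasurable measurable_centre.aemeasurable
  rw [measurePreserving_centre.map_eq, Measure.restrict_restrict measurableSet_Iic,
    Set.inter_comm, Set.Ioc_inter_Iic, min_eq_right hc1,
    ← intervalIntegral.integral_of_le hc0] at hmap
  rw [sublevelVec, L2.inner_indicatorConstLp_one, hmap]
  refine integral_congr_ae (ae_restrict_of_ae ?_)
  filter_upwards [coeFn_expVec t] with x hx
  exact hx

lemma inner_sublevelVec_sub (t : ℝ) (x : UnitAddCircle) :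
    inner ℂ (sublevelVec (centre x) - sublevelVec 0) (expVec t) =
      ∫ u in (0 : ℝ)..centre x, expLine t u := by
  rw [inner_sub_left, inner_sublevelVec_expVec t (abs_centre_le x),
    inner_sublevelVec_expVec t (by norm_num),
    intervalIntegral.integral_interval_sub_left] <;>
  exact (continuous_expLine t).intervalIntegrable _ _

theorem exists_Psi_eq_apply_expVec (a b : L2Z) :
    ∃ φ : L2Circle →L[ℂ] ℂ, ∀ t : ℝ, Psi a b t = φ (expVec t) := by
  set W : UnitAddCircle → L2Circle := fun x => sublevelVec (centre x) - sublevelVec 0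
  have hWm : StronglyMeasurable W :=
    (continuous_sublevelVec.comp_stronglyMeasurable measurable_centre.stronglyMeasurable).sub
      stronglyMeasurable_const
  have hW (x : UnitAddCircle) : ‖innerSL ℂ (W x)‖ ≤ 2 := by
    rw [innerSL_apply_norm]
    linarith [norm_sub_le (sublevelVec (centre x)) (sublevelVec 0), norm_sublevelVec_le (centre x),
      norm_sublevelVec_le 0]
  have hint : Integrable (fun x => density a b x • innerSL ℂ (W x)) haarAddCircle :=
    (integrable_density a b).smul_bdd 2
      ((innerSL ℂ).continuous.comp_stronglyMeasurable hWm).aestronglyMeasurable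
      (Eventually.of_forall hW)
  refine ⟨-(2 * Real.pi * Complex.I) •
    ∫ x, density a b x • innerSL ℂ (W x) ∂haarAddCircle, fun t => ?_⟩
  rw [smul_apply, ContinuousLinearMap.integral_apply hint, Psi_eq_integral, smul_eq_mul,
    ← integral_const_mul]
  refine integral_congr_ae (Eventually.of_forall fun x => ?_)
  simp only [smul_apply, innerSL_apply_apply, W, inner_sublevelVec_sub, smul_eq_mul]
  ring

end Psi

section Diagonal

variable {ι 𝕜 F : Type*} [NontriviallyNormedField 𝕜] [NormedAddCommGroup F] [NormedSpace 𝕜 F]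
  {p : ℝ≥0∞}

lemma single_eq_smul [DecidableEq ι] (i : ι) (c : 𝕜) :
    lp.single p i c = c • (lp.single p i 1 : lp (fun _ : ι => 𝕜) p) := by
  rw [← lp.single_smul, smul_eq_mul, mul_one]

variable [Fact (1 ≤ p)]

/-- The diagonal operator on `ℓᵖ` with bounded entries `d`. -/
def diagonal (p : ℝ≥0∞) [Fact (1 ≤ p)] {d : ι → 𝕜} {C : ℝ} (hC : 0 ≤ C) (hd : ∀ i, ‖d i‖ ≤ C) :
    lp (fun _ : ι => 𝕜) p →L[𝕜] lp (fun _ : ι => 𝕜) p :=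
  lp.mapCLM p (fun i => ContinuousLinearMap.mul 𝕜 𝕜 (d i)) hC fun i => by simpa using hd i

lemma diagonal_apply {d : ι → 𝕜} {C : ℝ} (hC : 0 ≤ C) (hd : ∀ i, ‖d i‖ ≤ C)
    (x : lp (fun _ : ι => 𝕜) p) (i : ι) : diagonal p hC hd x i = d i * x i := rfl

lemma norm_diagonal_le {d : ι → 𝕜} {C : ℝ} (hC : 0 ≤ C) (hd : ∀ i, ‖d i‖ ≤ C) :
    ‖diagonal p hC hd‖ ≤ C := lp.norm_mapCLM_le _ _ _ _

variable [DecidableEq ι]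

lemma diagonal_single {d : ι → 𝕜} {C : ℝ} (hC : 0 ≤ C) (hd : ∀ i, ‖d i‖ ≤ C) (i : ι) :
    diagonal p hC hd (lp.single p i 1) = d i • lp.single p i 1 := by
  ext j
  rw [diagonal_apply, lp.coeFn_smul, Pi.smul_apply, smul_eq_mul]
  rcases eq_or_ne j i with rfl | hij
  · rfl
  · rw [lp.single_apply_ne _ _ _ hij, mul_zero, mul_zero]

lemma ext_single (hp : p ≠ ∞) {A B : lp (fun _ : ι => 𝕜) p →L[𝕜] F}
    (h : ∀ i, A (lp.single p i 1) = B (lp.single p i 1)) : A = B :=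
  lp.ext_continuousLinearMap hp fun i => ContinuousLinearMap.ext_ring (h i)

/-- The projection of `ℓᵖ` onto the coordinates in a finite set. -/
def truncation (𝕜 : Type*) [NontriviallyNormedField 𝕜] (p : ℝ≥0∞) [Fact (1 ≤ p)] (S : Finset ι) :
    lp (fun _ : ι => 𝕜) p →L[𝕜] lp (fun _ : ι => 𝕜) p :=
  diagonal p (d := fun i => if i ∈ S then 1 else 0) zero_le_one fun i => by split_ifs <;> simp

lemma norm_truncation_le (S : Finset ι) : ‖truncation 𝕜 p S‖ ≤ 1 := norm_diagonal_le _ _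

lemma truncation_single (S : Finset ι) (i : ι) :
    truncation 𝕜 p S (lp.single p i 1) = if i ∈ S then lp.single p i 1 else 0 := by
  rw [truncation, diagonal_single, ite_smul, one_smul, zero_smul]

lemma truncation_eq_sum (S : Finset ι) (x : lp (fun _ : ι => 𝕜) p) :
    truncation 𝕜 p S x = ∑ i ∈ S, lp.single p i (x i) := by
  ext j
  rw [truncation, diagonal_apply, lp.coeFn_sum, Finset.sum_apply]
  simp only [lp.coeFn_single, Finset.sum_pi_single, ite_mul, one_mul, zero_mul]

lemma tendsto_truncation (hp : p ≠ ∞) (x : lp (fun _ : ι => 𝕜) p) :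
    Tendsto (fun S : Finset ι => truncation 𝕜 p S x) atTop (𝓝 x) := by
  simp_rw [truncation_eq_sum]
  exact lp.hasSum_single hp x

end Diagonal

section Perturbation

variable {𝕜 E F : Type*} [NontriviallyNormedField 𝕜] [NormedAddCommGroup E] [NormedSpace 𝕜 E]
  [NormedAddCommGroup F] [NormedSpace 𝕜 F]

lemma tendstoUniformlyOn_of_tendsto_of_norm_le {ι X : Type*} [TopologicalSpace X] {l : Filter ι}
    {P : ι → E →L[𝕜] F} {Q : E →L[𝕜] F} {C : ℝ} (hP : ∀ i, ‖P i‖ ≤ C)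
    (hPQ : ∀ x, Tendsto (fun i => P i x) l (𝓝 (Q x))) {f : X → E} (hf : Continuous f)
    {K : Set X} (hK : IsCompact K) :
    TendstoUniformlyOn (fun i t => P i (f t)) (fun t => Q (f t)) l K := by
  have hequi : UniformEquicontinuous fun i x => P i x :=
    LipschitzWith.uniformEquicontinuous _ C.toNNReal fun i =>
      (P i).lipschitz.weaken (by rw [← norm_toNNReal]; exact Real.toNNReal_le_toNNReal (hP i))
  have hcomp : Equicontinuous fun i t => P i (f t) := fun t V hV =>
    hf.continuousAt.eventually (hequi.equicontinuous (f t) V hV)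
  have hlim := (EquicontinuousOn.tendsto_uniformOnFun_iff_pi' (𝔖 := {K}) (by simpa using hK)
    (fun K _ => hcomp.equicontinuousOn K) l fun t => Q (f t)).2
      (tendsto_pi_nhds.2 fun t => hPQ (f t))
  exact UniformOnFun.tendsto_iff_tendstoUniformlyOn.1 hlim K rfl

lemma le_norm_apply_of_norm_sub_le (U : E ≃ₗᵢ[𝕜] F) {D : E →L[𝕜] F} {θ : ℝ}
    (hD : ‖(U.toContinuousLinearEquiv : E →L[𝕜] F) - D‖ ≤ θ) (x : E) :
    (1 - θ) * ‖x‖ ≤ ‖D x‖ := by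
  have hsub : ‖U x - D x‖ ≤ θ * ‖x‖ :=
    ContinuousLinearMap.le_of_opNorm_le ((U.toContinuousLinearEquiv : E →L[𝕜] F) - D) hD x
  have htri := norm_sub_norm_le (U x) (D x)
  rw [U.norm_map] at htri
  linarith

lemma exists_equiv_of_norm_sub_lt_one [CompleteSpace E] (U : E ≃ₗᵢ[𝕜] F) {D : E →L[𝕜] F}
    (hD : ‖(U.toContinuousLinearEquiv : E →L[𝕜] F) - D‖ < 1) :
    ∃ T : E ≃L[𝕜] F, (T : E →L[𝕜] F) = D := by
  set R : E →L[𝕜] E := (U.symm.toContinuousLinearEquiv : F →L[𝕜] E) ∘L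
    ((U.toContinuousLinearEquiv : E →L[𝕜] F) - D)
  have hR : ‖R‖ < 1 := by
    refine lt_of_le_of_lt (ContinuousLinearMap.opNorm_le_bound _ (norm_nonneg _) fun x => ?_) hD
    exact (U.symm.norm_map _).trans_le (ContinuousLinearMap.le_opNorm _ x)
  refine ⟨(ContinuousLinearEquiv.unitsEquiv 𝕜 E (Units.oneSub R hR)).trans
    U.toContinuousLinearEquiv, ContinuousLinearMap.ext fun x => ?_⟩
  change U (x - U.symm (U x - D x)) = D x
  rw [map_sub, U.apply_symm_apply, sub_sub_cancel]

lemma tendsto_symm_of_tendsto {ι : Type*} {l : Filter ι} {V : ι → E ≃L[𝕜] F} {T : E ≃L[𝕜] F}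
    {c : ℝ} (hc : 0 < c) (hV : ∀ i x, c * ‖x‖ ≤ ‖V i x‖)
    (hVT : ∀ x, Tendsto (fun i => V i x) l (𝓝 (T x))) (f : F) :
    Tendsto (fun i => (V i).symm f) l (𝓝 (T.symm f)) := by
  rw [tendsto_iff_norm_sub_tendsto_zero]
  have hlim : Tendsto (fun i => ‖f - V i (T.symm f)‖ / c) l (𝓝 0) := by
    have := ((tendsto_const_nhds (x := f)).sub (hVT (T.symm f))).norm.div_const c
    rwa [T.apply_symm_apply, sub_self, norm_zero, zero_div] at this
  refine squeeze_zero (fun i => norm_nonneg _) (fun i => ?_) hlim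
  have hbound := hV i ((V i).symm f - T.symm f)
  rw [map_sub, ContinuousLinearEquiv.apply_symm_apply] at hbound
  rwa [le_div_iff₀ hc, mul_comm]

end Perturbation

section Kadec

lemma hasSum_int_of_even_of_odd {M : Type*} [AddCommMonoid M] [TopologicalSpace M]
    [ContinuousAdd M] {f : ℤ → M} {a b : M} (ha : HasSum (fun n : ℤ => f (2 * n)) a)
    (hb : HasSum (fun n : ℤ => f (2 * n + 1)) b) : HasSum f (a + b) := by
  have heven : Function.Injective fun n : ℤ => 2 * n := fun m n h => by simpa using h
  have hodd : Function.Injective fun n : ℤ => 2 * n + 1 := fun m n h => by simpa using h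
  have hcompl : IsCompl (Set.range fun n : ℤ => 2 * n) (Set.range fun n : ℤ => 2 * n + 1) := by
    convert! Int.isCompl_even_odd using 1
    · ext n
      simp [even_iff_exists_two_mul]
    · ext n
      simp [Odd]
  exact HasSum.add_isCompl hcompl (heven.hasSum_range_iff.2 ha) (hodd.hasSum_range_iff.2 hb)

lemma hasSum_nat_inv_sq_sub_quarter :
    HasSum (fun n : ℕ => 1 / (((n : ℝ) + 1) ^ 2 - 1 / 4)) 2 := by
  have htelescope (n : ℕ) : 1 / (((n : ℝ) + 1) ^ 2 - 1 / 4) =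
      1 / ((n : ℝ) + 1 / 2) - 1 / (((n + 1 : ℕ) : ℝ) + 1 / 2) := by
    have hn : (n : ℝ) + 1 / 2 ≠ 0 := by positivity
    have hn' : (n : ℝ) + 1 + 1 / 2 ≠ 0 := by positivity
    have hfactor : ((n : ℝ) + 1) ^ 2 - 1 / 4 = (n + 1 / 2) * (n + 1 + 1 / 2) := by ring
    push_cast
    rw [hfactor, div_sub_div _ _ hn hn']
    congr 1
    ring
  rw [hasSum_iff_tendsto_nat_of_nonneg fun n => ?_]
  · simp_rw [htelescope, Finset.sum_range_sub' fun n : ℕ => 1 / ((n : ℝ) + 1 / 2)]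
    have hlim : Tendsto (fun n : ℕ => 1 / ((n : ℝ) + 1 / 2)) atTop (𝓝 0) :=
      tendsto_const_nhds.div_atTop
        (tendsto_atTop_add_const_right _ _ tendsto_natCast_atTop_atTop)
    convert hlim.const_sub (1 / (((0 : ℕ) : ℝ) + 1 / 2)) using 2
    norm_num
  · have : (0 : ℝ) ≤ n := Nat.cast_nonneg n
    exact one_div_nonneg.2 (by nlinarith)

lemma hasSum_int_inv_sq_sub_quarter :
    HasSum (fun m : ℤ => if m = 0 then (0 : ℝ) else 1 / ((m : ℝ) ^ 2 - 1 / 4)) 4 := by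
  have hpos : HasSum (fun n : ℕ => if (n + 1 : ℤ) = 0 then (0 : ℝ)
      else 1 / (((n + 1 : ℤ) : ℝ) ^ 2 - 1 / 4)) 2 := by
    convert hasSum_nat_inv_sq_sub_quarter using 2 with n
    rw [if_neg (by omega)]
    push_cast
    rfl
  have hneg : HasSum (fun n : ℕ => if -(n + 1 : ℤ) = 0 then (0 : ℝ)
      else 1 / (((-(n + 1 : ℤ) : ℤ) : ℝ) ^ 2 - 1 / 4)) 2 := by
    simpa only [neg_eq_zero, Int.cast_neg, neg_sq] using hpos
  convert HasSum.of_add_one_of_neg_add_one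
    (f := fun m : ℤ => if m = 0 then (0 : ℝ) else 1 / ((m : ℝ) ^ 2 - 1 / 4)) hpos hneg using 1
  norm_num

/-- The coefficients of `1 - expFun δ` in terms of the exponentials of half-integer frequency:
cosines of integer frequency for the even part, sines of half-integer frequency for the odd part. -/
def kadecCoeff (m : ℤ) (δ : ℝ) : ℝ :=
  (if m = 0 then 1 else 0) - 2⁻¹ * (Real.sinc (Real.pi * (δ - m / 2)) +
    (-1) ^ m * Real.sinc (Real.pi * (δ + m / 2)))

lemma hasSum_expVec (f : L2Circle) :
    HasSum (fun n : ℤ => (inner ℂ (expVec n) f : ℂ) • expVec n) f := by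
  simpa only [HilbertBasis.repr_apply_apply, expBasis_apply] using expBasis.hasSum_repr f

lemma hasSum_kadecCoeff_even (δ : ℝ) :
    HasSum (fun n : ℤ => (kadecCoeff (2 * n) δ : ℂ) • expVec ((2 * n : ℤ) / 2 : ℝ))
      (expVec 0 - (2⁻¹ : ℂ) • (expVec δ + expVec (-δ))) := by
  convert hasSum_expVec (expVec 0 - (2⁻¹ : ℂ) • (expVec δ + expVec (-δ))) using 2 with n
  have hhalf : (((2 * n : ℤ) : ℝ) / 2) = n := by push_cast; ring
  have hsinc : Real.sinc (Real.pi * (-δ - n)) = Real.sinc (Real.pi * (δ + n)) := by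
    rw [← Real.sinc_neg]
    ring_nf
  have hzero : Real.sinc (Real.pi * (0 - n)) = if n = 0 then 1 else 0 := by
    rw [← sinc_pi_mul_intCast, ← Real.sinc_neg]
    ring_nf
  rw [inner_sub_right, inner_smul_right, inner_add_right, inner_expVec, inner_expVec,
    inner_expVec, kadecCoeff, hhalf, (even_two_mul n).neg_one_zpow, hsinc, hzero]
  congr 1
  rcases eq_or_ne n 0 with hn | hn <;> simp [hn]

lemma hasSum_kadecCoeff_odd (δ : ℝ) :
    HasSum (fun n : ℤ => (kadecCoeff (2 * n + 1) δ : ℂ) • expVec ((2 * n + 1 : ℤ) / 2 : ℝ))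
      ((2⁻¹ : ℂ) • (expVec (-δ) - expVec δ)) := by
  have hshift : (2⁻¹ : ℂ) • (expVec (-δ) - expVec δ) =
      modulation (1 / 2) ((2⁻¹ : ℂ) • (expVec (-δ - 1 / 2) - expVec (δ - 1 / 2))) := by
    rw [map_smul, map_sub, modulation_expVec, modulation_expVec, add_sub_cancel, add_sub_cancel]
  rw [hshift]
  convert (hasSum_expVec _).mapL (modulation (1 / 2)) using 2 with n
  have hhalf : (((2 * n + 1 : ℤ) : ℝ) / 2) = 1 / 2 + n := by push_cast; ring
  have hsinc : Real.sinc (Real.pi * (-δ - 1 / 2 - n)) =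
      Real.sinc (Real.pi * (δ + (1 / 2 + n))) := by
    rw [← Real.sinc_neg]
    ring_nf
  rw [map_smul, modulation_expVec, inner_smul_right, inner_sub_right, inner_expVec,
    inner_expVec, kadecCoeff, hhalf, (odd_two_mul_add_one n).neg_one_zpow, hsinc, sub_sub δ,
    if_neg (by omega)]
  congr 1
  push_cast
  ring

lemma hasSum_kadecCoeff (δ : ℝ) :
    HasSum (fun m : ℤ => (kadecCoeff m δ : ℂ) • expVec (m / 2 : ℝ)) (expVec 0 - expVec δ) := by
  convert hasSum_int_of_even_of_odd (f := fun m : ℤ => (kadecCoeff m δ : ℂ) • expVec (m / 2 : ℝ))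
    (hasSum_kadecCoeff_even δ) (hasSum_kadecCoeff_odd δ) using 1
  module

lemma kadecCoeff_zero (δ : ℝ) : kadecCoeff 0 δ = 1 - Real.sinc (Real.pi * δ) := by
  rw [kadecCoeff, if_pos rfl, zpow_zero, Int.cast_zero, zero_div, sub_zero, add_zero]
  ring

lemma half_int_sq_sub_sq_pos {m : ℤ} (hm : m ≠ 0) {δ : ℝ} (hδ : |δ| < 1 / 2) :
    0 < ((m : ℝ) / 2) ^ 2 - δ ^ 2 := by
  have hm1 : (1 : ℝ) ≤ |(m : ℝ)| := by exact_mod_cast Int.one_le_abs hm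
  have : |δ| < |(m : ℝ) / 2| := by
    rw [abs_div, abs_two]
    linarith
  exact sub_pos.2 (sq_lt_sq.2 this)

lemma kadecCoeff_of_ne_zero {m : ℤ} (hm : m ≠ 0) {δ : ℝ} (hδ : |δ| < 1 / 2) :
    kadecCoeff m δ =
      δ * Real.sin (Real.pi * (δ - m / 2)) / (Real.pi * ((m / 2) ^ 2 - δ ^ 2)) := by
  have hprod : (m / 2 - δ) * (m / 2 + δ) ≠ 0 := by
    convert (half_int_sq_sub_sq_pos hm hδ).ne' using 1
    ring
  have hsub : δ - m / 2 ≠ 0 := fun h => left_ne_zero_of_mul hprod (by linarith)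
  have hadd : δ + m / 2 ≠ 0 := fun h => right_ne_zero_of_mul hprod (by linarith)
  have hsin : (-1) ^ m * Real.sin (Real.pi * (δ + m / 2)) = Real.sin (Real.pi * (δ - m / 2)) := by
    rw [← Real.sin_sub_int_mul_pi]
    ring_nf
  rw [kadecCoeff, if_neg hm, Real.sinc_of_ne_zero (mul_ne_zero Real.pi_ne_zero hsub),
    Real.sinc_of_ne_zero (mul_ne_zero Real.pi_ne_zero hadd), mul_div_assoc', hsin]
  have hden : ((m : ℝ) / 2) ^ 2 - δ ^ 2 = -((δ - m / 2) * (δ + m / 2)) := by ring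
  rw [hden]
  generalize Real.sin (Real.pi * (δ - m / 2)) = s
  generalize (m : ℝ) / 2 = w at hsub hadd ⊢
  field_simp
  ring

lemma abs_sin_sub_half_int (m : ℤ) (x : ℝ) : |Real.sin (Real.pi * (x - m / 2))| =
    if Even m then |Real.sin (Real.pi * x)| else |Real.cos (Real.pi * x)| := by
  split_ifs with hm
  · obtain ⟨n, rfl⟩ := hm
    have : Real.pi * (x - ((n + n : ℤ) : ℝ) / 2) = Real.pi * x - n * Real.pi := by push_cast; ring
    rw [this, Real.sin_sub_int_mul_pi, abs_mul, abs_neg_one_zpow, one_mul]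
  · obtain ⟨n, rfl⟩ := Int.not_even_iff_odd.1 hm
    have : Real.pi * (x - ((2 * n + 1 : ℤ) : ℝ) / 2) =
        -(Real.pi / 2 - (Real.pi * x - n * Real.pi)) := by push_cast; ring
    rw [this, Real.sin_neg, Real.sin_pi_div_two_sub, Real.cos_sub_int_mul_pi, abs_neg, abs_mul,
      abs_neg_one_zpow, one_mul]

lemma mul_cos_pi_mul_le {x L : ℝ} (hx : 0 ≤ x) (hxL : x ≤ L) (hL : L ≤ 1 / 4) :
    x * Real.cos (Real.pi * x) ≤ L * Real.cos (Real.pi * L) := by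
  have hpi := Real.pi_pos
  set y := Real.pi * (L - x)
  have hy : 0 ≤ y := mul_nonneg hpi.le (sub_nonneg.2 hxL)
  have hcos : 0 ≤ Real.cos (Real.pi * L) :=
    Real.cos_nonneg_of_mem_Icc ⟨by nlinarith, by nlinarith⟩
  have hsin : Real.sin (Real.pi * L) ≤ Real.cos (Real.pi * L) := by
    rw [← Real.sin_pi_div_two_sub]
    exact Real.sin_le_sin_of_le_of_le_pi_div_two (by nlinarith) (by nlinarith) (by nlinarith)
  have hcos_le : Real.cos (Real.pi * x) ≤ Real.cos (Real.pi * L) * (1 + y) := by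
    have hxy : Real.pi * x = Real.pi * L - y := by ring
    rw [hxy, Real.cos_sub, mul_add]
    exact add_le_add (mul_le_mul_of_nonneg_left (Real.cos_le_one y) hcos)
      (mul_le_mul hsin (Real.sin_le hy) (Real.sin_nonneg_of_nonneg_of_le_pi hy (by nlinarith)) hcos)
  have hlin : x * (1 + y) ≤ L := by
    have : Real.pi * x ≤ 1 := by nlinarith [Real.pi_lt_four]
    nlinarith
  calc x * Real.cos (Real.pi * x)
      ≤ x * (Real.cos (Real.pi * L) * (1 + y)) := mul_le_mul_of_nonneg_left hcos_le hx
    _ = x * (1 + y) * Real.cos (Real.pi * L) := by ring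
    _ ≤ L * Real.cos (Real.pi * L) := mul_le_mul_of_nonneg_right hlin hcos

lemma strictAntiOn_sinc : StrictAntiOn Real.sinc (Set.Icc 0 Real.pi) := by
  rintro x ⟨hx0, hx⟩ y ⟨hy0, hy⟩ hxy
  rw [Real.sinc_of_ne_zero (hx0.trans_lt hxy).ne']
  rcases hx0.eq_or_lt with rfl | hx0
  · rw [Real.sinc_zero, div_lt_one hxy]
    exact Real.sin_lt hxy
  · rw [Real.sinc_of_ne_zero hx0.ne']
    simpa using strictConcaveOn_sin_Icc.secant_strict_mono ⟨le_rfl, Real.pi_pos.le⟩ ⟨hx0.le, hx⟩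
      ⟨hy0, hy⟩ hx0.ne' (hx0.trans hxy).ne' hxy

lemma abs_mul_abs_sin_sub_half_int_le (m : ℤ) {δ L : ℝ} (hδ : |δ| ≤ L) (hL : L ≤ 1 / 4) :
    |δ| * |Real.sin (Real.pi * (δ - m / 2))| ≤ L * |Real.sin (Real.pi * (L - m / 2))| := by
  have hpi := Real.pi_pos
  have hδ0 := abs_nonneg δ
  have hπδ : |Real.pi * δ| = Real.pi * |δ| := by rw [abs_mul, abs_of_pos hpi]
  rw [abs_sin_sub_half_int, abs_sin_sub_half_int]
  split_ifs
  · have hsin : Real.sin (Real.pi * |δ|) ≤ Real.sin (Real.pi * L) :=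
      Real.sin_le_sin_of_le_of_le_pi_div_two (by nlinarith) (by nlinarith) (by gcongr)
    have habs : |Real.sin (Real.pi * δ)| = Real.sin (Real.pi * |δ|) := by
      rw [Real.abs_sin_eq_sin_abs_of_abs_le_pi (by rw [hπδ]; nlinarith), hπδ]
    rw [habs]
    exact mul_le_mul hδ (hsin.trans (le_abs_self _)) (habs ▸ abs_nonneg _) (hδ0.trans hδ)
  · have hcos (x : ℝ) (hx : |x| ≤ 1 / 4) : |Real.cos (Real.pi * x)| = Real.cos (Real.pi * |x|) := by
      have hxpi : |Real.pi * x| = Real.pi * |x| := by rw [abs_mul, abs_of_pos hpi]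
      rw [← hxpi, Real.cos_abs]
      exact abs_of_nonneg (Real.cos_nonneg_of_mem_Icc (abs_le.1 (by rw [hxpi]; nlinarith)))
    have hL0 : |L| = L := abs_of_nonneg (hδ0.trans hδ)
    rw [hcos δ (hδ.trans hL), hcos L (hL0.trans_le hL), hL0]
    exact mul_cos_pi_mul_le hδ0 hδ hL

lemma abs_kadecCoeff_le (m : ℤ) {δ L : ℝ} (hδ : |δ| ≤ L) (hL : L ≤ 1 / 4) :
    |kadecCoeff m δ| ≤ |kadecCoeff m L| := by
  have hpi := Real.pi_pos
  have hL0 : |L| = L := abs_of_nonneg ((abs_nonneg δ).trans hδ)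
  rcases eq_or_ne m 0 with rfl | hm
  · have hsinc : Real.sinc (Real.pi * δ) = Real.sinc (Real.pi * |δ|) := by
      rcases abs_choice δ with h | h <;> rw [h]
      rw [mul_neg, Real.sinc_neg]
    have hanti : Real.sinc (Real.pi * L) ≤ Real.sinc (Real.pi * |δ|) :=
      strictAntiOn_sinc.antitoneOn ⟨by positivity, by nlinarith⟩
        ⟨hL0 ▸ by positivity, by nlinarith⟩ (by gcongr)
    rw [kadecCoeff_zero, kadecCoeff_zero, hsinc,
      abs_of_nonneg (sub_nonneg.2 (Real.sinc_le_one _)),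
      abs_of_nonneg (sub_nonneg.2 (Real.sinc_le_one _))]
    linarith
  · have hposL := half_int_sq_sub_sq_pos hm (δ := L) (by linarith)
    have hden : (m / 2) ^ 2 - L ^ 2 ≤ (m / 2) ^ 2 - δ ^ 2 :=
      sub_le_sub_left (sq_le_sq.2 (hδ.trans_eq hL0.symm)) _
    rw [kadecCoeff_of_ne_zero hm (by linarith), kadecCoeff_of_ne_zero hm (by linarith),
      abs_div, abs_div, abs_of_pos (mul_pos hpi hposL),
      abs_of_pos (mul_pos hpi (hposL.trans_le hden)), abs_mul, abs_mul, hL0]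
    exact div_le_div₀ (by rw [← hL0]; positivity) (abs_mul_abs_sin_sub_half_int_le m hδ hL)
      (mul_pos hpi hposL) (mul_le_mul_of_nonneg_left hden hpi.le)

lemma hasSum_abs_kadecCoeff_quarter : HasSum (fun m => |kadecCoeff m (1 / 4)|) 1 := by
  have hquarter : Real.pi * (1 / 4) = Real.pi / 4 := by ring
  have hpi := Real.pi_pos
  have hterm (m : ℤ) : |kadecCoeff m (1 / 4)| = (if m = 0 then 1 - 2 * √2 / Real.pi else 0) +
      √2 / (2 * Real.pi) * if m = 0 then (0 : ℝ) else 1 / ((m : ℝ) ^ 2 - 1 / 4) := by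
    rcases eq_or_ne m 0 with rfl | hm
    · rw [if_pos rfl, if_pos rfl, mul_zero, add_zero, kadecCoeff_zero,
        abs_of_nonneg (sub_nonneg.2 (Real.sinc_le_one _)), hquarter,
        Real.sinc_of_ne_zero (by positivity), Real.sin_pi_div_four]
      field_simp
      ring
    · have hpos := half_int_sq_sub_sq_pos hm (δ := 1 / 4) (by norm_num)
      have : 0 < (m : ℝ) ^ 2 - 1 / 4 := by linarith
      have hsin : |Real.sin (Real.pi * (1 / 4 - m / 2))| = √2 / 2 := by
        rw [abs_sin_sub_half_int, hquarter, Real.sin_pi_div_four, Real.cos_pi_div_four, ite_self,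
          abs_of_nonneg (by positivity)]
      rw [if_neg hm, if_neg hm, zero_add, kadecCoeff_of_ne_zero hm (by norm_num), abs_div, abs_mul,
        hsin, abs_of_pos (mul_pos hpi hpos), abs_of_pos (by norm_num)]
      have hden : ((m : ℝ) / 2) ^ 2 - (1 / 4) ^ 2 = ((m : ℝ) ^ 2 - 1 / 4) / 4 := by ring
      rw [hden]
      field_simp
  simp_rw [hterm]
  convert (hasSum_ite_eq 0 (1 - 2 * √2 / Real.pi)).add
    (hasSum_int_inv_sq_sub_quarter.mul_left (√2 / (2 * Real.pi))) using 1
  field_simp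
  ring

/-- A bound for the norm of the perturbation that moves each integer frequency by at most `L`. -/
def kadecConst (L : ℝ) : ℝ := ∑' m, |kadecCoeff m L|

lemma summable_abs_kadecCoeff {L : ℝ} (hL0 : 0 ≤ L) (hL : L ≤ 1 / 4) :
    Summable fun m => |kadecCoeff m L| :=
  hasSum_abs_kadecCoeff_quarter.summable.of_nonneg_of_le (fun _ => abs_nonneg _)
    fun m => abs_kadecCoeff_le m (by rwa [abs_of_nonneg hL0]) le_rfl

lemma kadecConst_lt_one {L : ℝ} (hL0 : 0 ≤ L) (hL : L < 1 / 4) : kadecConst L < 1 := by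
  have hpi := Real.pi_pos
  rw [kadecConst, ← hasSum_abs_kadecCoeff_quarter.tsum_eq]
  refine (summable_abs_kadecCoeff hL0 hL.le).tsum_lt_tsum (i := 0)
    (fun m => abs_kadecCoeff_le m (by rw [abs_of_nonneg hL0]; exact hL.le) le_rfl) ?_
    hasSum_abs_kadecCoeff_quarter.summable
  rw [kadecCoeff_zero, kadecCoeff_zero, abs_of_nonneg (sub_nonneg.2 (Real.sinc_le_one _)),
    abs_of_nonneg (sub_nonneg.2 (Real.sinc_le_one _))]
  exact sub_lt_sub_left (strictAntiOn_sinc ⟨by positivity, by nlinarith⟩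
    ⟨by positivity, by nlinarith⟩ (by gcongr)) _

/-- The unitary synthesis operator of the integer exponentials. -/
def synthesis : L2Z ≃ₗᵢ[ℂ] L2Circle := expBasis.repr.symm

lemma synthesis_single (k : ℤ) : synthesis (lp.single 2 k 1) = expVec k := by
  rw [synthesis, HilbertBasis.repr_symm_single, expBasis_apply]

variable {τ : ℤ → ℝ} {L : ℝ}

theorem exists_kadec_perturbation (hL : L ≤ 1 / 4) (hτ : ∀ k, |τ k - k| ≤ L) :
    ∃ B : L2Z →L[ℂ] L2Circle, ‖B‖ ≤ kadecConst L ∧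
      ∀ k, B (lp.single 2 k 1) = expVec k - expVec (τ k) := by
  have hd (m k : ℤ) : ‖(kadecCoeff m (τ k - k) : ℂ)‖ ≤ |kadecCoeff m L| := by
    rw [Complex.norm_real]
    exact abs_kadecCoeff_le m (hτ k) hL
  set U := (synthesis.toContinuousLinearEquiv : L2Z →L[ℂ] L2Circle)
  set X : ℤ → L2Z →L[ℂ] L2Circle := fun m =>
    modulation (m / 2) ∘L U ∘L diagonal 2 (abs_nonneg _) (hd m)
  have hX (m : ℤ) : ‖X m‖ ≤ |kadecCoeff m L| := by
    refine (ContinuousLinearMap.opNorm_comp_le _ _).trans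
      ((mul_le_of_le_one_left (norm_nonneg _) (norm_modulation_le _)).trans ?_)
    refine ContinuousLinearMap.opNorm_le_bound _ (abs_nonneg _) fun x => ?_
    exact (synthesis.norm_map _).trans_le
      (ContinuousLinearMap.le_of_opNorm_le _ (norm_diagonal_le _ _) x)
  have hsum := summable_abs_kadecCoeff ((abs_nonneg _).trans (hτ 0)) hL
  refine ⟨∑' m, X m, tsum_of_norm_bounded hsum.hasSum hX, fun k => ?_⟩
  have hB := (Summable.of_norm_bounded hsum hX).hasSum.mapL
    (ContinuousLinearMap.apply ℂ L2Circle (lp.single 2 k 1 : L2Z))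
  have hseries := (hasSum_kadecCoeff (τ k - k)).mapL (modulation k)
  rw [map_sub, modulation_expVec, modulation_expVec, add_zero, add_sub_cancel] at hseries
  refine hB.unique ?_
  convert! hseries using 2 with m
  change modulation (m / 2) (synthesis (diagonal 2 _ (hd m) (lp.single 2 k 1))) = _
  rw [diagonal_single, map_smul, map_smul, synthesis_single, map_smul, modulation_expVec,
    modulation_expVec, add_comm]

theorem exists_riesz_equiv (hL : L < 1 / 4) (hτ : ∀ k, |τ k - k| ≤ L) :
    ∃ T : L2Z ≃L[ℂ] L2Circle, (∀ k, T (lp.single 2 k 1) = expVec (τ k)) ∧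
      ∀ x, (1 - kadecConst L) * ‖x‖ ≤ ‖T x‖ := by
  obtain ⟨B, hB, hBsingle⟩ := exists_kadec_perturbation hL.le hτ
  set U := (synthesis.toContinuousLinearEquiv : L2Z →L[ℂ] L2Circle)
  have hUB : ‖U - (U - B)‖ ≤ kadecConst L := by rwa [sub_sub_cancel]
  obtain ⟨T, hT⟩ := exists_equiv_of_norm_sub_lt_one synthesis
    (hUB.trans_lt (kadecConst_lt_one ((abs_nonneg _).trans (hτ 0)) hL))
  refine ⟨T, fun k => ?_, fun x => ?_⟩
  · rw [← T.coe_coe, hT]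
    change synthesis _ - B _ = _
    rw [hBsingle, synthesis_single, sub_sub_cancel]
  · rw [← T.coe_coe, hT]
    exact le_norm_apply_of_norm_sub_le synthesis hUB x

end Kadec

section CanonicalProduct

lemma tprod_eq_zero_iff_of_summable {ι : Type*} {f : ι → ℂ}
    (hf : Summable fun i => ‖f i - 1‖) : ∏' i, f i = 0 ↔ ∃ i, f i = 0 := by
  refine ⟨fun h => ?_, tprod_of_exists_eq_zero⟩
  by_contra! hne
  have := tprod_one_add_ne_zero_of_summable (f := fun i => f i - 1) (by simpa using hne) hf
  simp only [add_sub_cancel] at this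
  exact this h

lemma differentiable_tprod {f : ℕ → ℂ → ℂ} {u : ℝ → ℕ → ℝ} (hf : ∀ k, Differentiable ℂ (f k))
    (hu : ∀ R, Summable (u R)) (hfu : ∀ R k z, ‖z‖ ≤ R → ‖f k z - 1‖ ≤ u R k) :
    Differentiable ℂ fun z => ∏' k, f k z := by
  intro z
  set D := Metric.ball (0 : ℂ) (‖z‖ + 1)
  have hprod := Summable.hasProdLocallyUniformlyOn_nat_one_add (f := fun k w => f k w - 1)
    (K := D) Metric.isOpen_ball (hu (‖z‖ + 1))
    (Eventually.of_forall fun k w hw => hfu _ k w (mem_ball_zero_iff.1 hw).le)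
    (fun k => ((hf k).continuous.sub continuous_const).continuousOn)
  simp only [add_sub_cancel] at hprod
  refine (hprod.differentiableOn (Eventually.of_forall fun s => ?_)
    Metric.isOpen_ball).differentiableAt (Metric.isOpen_ball.mem_nhds (by simp))
  exact DifferentiableOn.fun_finsetProd fun k _ => (hf k).differentiableOn

lemma differentiable_pairFactor (τ : ℤ → ℝ) (k : ℕ) : Differentiable ℂ (pairFactor τ k) := by
  unfold pairFactor
  fun_prop

variable {τ : ℤ → ℝ} {L : ℝ}

lemma one_sub_mul_abs_le_abs_node (hτ : ∀ k, |τ k - k| ≤ L) (k : ℤ) :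
    (1 - L) * |(k : ℝ)| ≤ |τ k| := by
  have hL0 : 0 ≤ L := (abs_nonneg _).trans (hτ 0)
  rcases eq_or_ne k 0 with rfl | hk
  · simp
  · have hk1 : (1 : ℝ) ≤ |(k : ℝ)| := by exact_mod_cast Int.one_le_abs hk
    have htri := abs_sub_abs_le_abs_sub (k : ℝ) (τ k)
    rw [abs_sub_comm] at htri
    nlinarith [hτ k]

lemma node_ne_zero (hL : L < 1) (hτ : ∀ k, |τ k - k| ≤ L) {k : ℤ} (hk : k ≠ 0) : τ k ≠ 0 := by
  have hk0 : (0 : ℝ) < |(k : ℝ)| := abs_pos.2 (Int.cast_ne_zero.2 hk)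
  exact abs_pos.1 ((mul_pos (sub_pos.2 hL) hk0).trans_le (one_sub_mul_abs_le_abs_node hτ k))

lemma abs_node_add_node_neg_le (hτ : ∀ k, |τ k - k| ≤ L) (k : ℤ) :
    |τ k + τ (-k)| ≤ 2 * L := by
  have hneg := hτ (-k)
  push_cast at hneg
  calc |τ k + τ (-k)| = |(τ k - k) + (τ (-k) - -k)| := by ring_nf
    _ ≤ 2 * L := (abs_add_le _ _).trans (by linarith [hτ k])

lemma pairFactor_sub_one_eq (hL : L < 1) (hτ : ∀ k, |τ k - k| ≤ L) {k : ℕ} (hk : k ≠ 0) (z : ℂ) :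
    pairFactor τ k z - 1 =
      (z ^ 2 - z * (τ k + τ (-k) : ℝ)) / (τ k * τ (-k) : ℝ) := by
  have hpos : (τ k : ℂ) ≠ 0 := Complex.ofReal_ne_zero.2 (node_ne_zero hL hτ (by simpa using hk))
  have hneg : (τ (-k) : ℂ) ≠ 0 :=
    Complex.ofReal_ne_zero.2 (node_ne_zero hL hτ (by simpa using hk))
  rw [pairFactor]
  push_cast
  field_simp
  ring

lemma norm_pairFactor_sub_one_le (hL : L < 1) (hτ : ∀ k, |τ k - k| ≤ L) {k : ℕ} (hk : k ≠ 0)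
    {z : ℂ} {R : ℝ} (hz : ‖z‖ ≤ R) :
    ‖pairFactor τ k z - 1‖ ≤ (R ^ 2 + R * (2 * L)) / (1 - L) ^ 2 * (1 / (k : ℝ) ^ 2) := by
  have hR : 0 ≤ R := (norm_nonneg z).trans hz
  have hL0 : 0 ≤ L := (abs_nonneg _).trans (hτ 0)
  have : 0 < 1 - L := sub_pos.2 hL
  have hk0 : (0 : ℝ) < k := by positivity
  have hnum : ‖z ^ 2 - z * (τ k + τ (-k) : ℝ)‖ ≤ R ^ 2 + R * (2 * L) := by
    refine (norm_sub_le _ _).trans ?_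
    rw [norm_pow, norm_mul, Complex.norm_real, Real.norm_eq_abs]
    gcongr
    exact abs_node_add_node_neg_le hτ k
  have hden : (1 - L) ^ 2 * k ^ 2 ≤ ‖((τ k * τ (-k) : ℝ) : ℂ)‖ := by
    have hpos := one_sub_mul_abs_le_abs_node hτ k
    have hneg := one_sub_mul_abs_le_abs_node hτ (-k)
    rw [Int.cast_neg, abs_neg] at hneg
    rw [Int.cast_natCast, abs_of_pos hk0] at hpos hneg
    rw [Complex.norm_real, Real.norm_eq_abs, abs_mul, ← mul_pow, sq]
    gcongr
  rw [pairFactor_sub_one_eq hL hτ hk, norm_div, div_mul_div_comm, mul_one]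
  exact div_le_div₀ (by positivity) hnum (by positivity) hden

lemma summable_one_div_succ_sq : Summable fun k : ℕ => 1 / ((k + 1 : ℕ) : ℝ) ^ 2 :=
  (summable_nat_add_iff 1).2 (Real.summable_one_div_nat_pow.2 one_lt_two)

lemma summable_norm_pairFactor_sub_one (hL : L < 1) (hτ : ∀ k, |τ k - k| ≤ L) (z : ℂ) :
    Summable fun k : ℕ => ‖pairFactor τ (k + 1) z - 1‖ :=
  (summable_one_div_succ_sq.mul_left _).of_nonneg_of_le (fun _ => norm_nonneg _)
    fun k => norm_pairFactor_sub_one_le hL hτ k.succ_ne_zero le_rfl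

theorem multipliable_pairFactor (hL : L < 1) (hτ : ∀ k, |τ k - k| ≤ L) (z : ℂ) :
    Multipliable fun k : ℕ => pairFactor τ (k + 1) z := by
  simpa using multipliable_one_add_of_summable (summable_norm_pairFactor_sub_one hL hτ z)

theorem differentiable_G (hL : L < 1) (hτ : ∀ k, |τ k - k| ≤ L) : Differentiable ℂ (G τ) :=
  (differentiable_id.sub_const _).mul <|
    differentiable_tprod (fun k => differentiable_pairFactor τ (k + 1))
      (fun _ => summable_one_div_succ_sq.mul_left _)
      fun _ k _ => norm_pairFactor_sub_one_le hL hτ k.succ_ne_zero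

lemma pairFactor_eq_zero_iff (hL : L < 1) (hτ : ∀ k, |τ k - k| ≤ L) {k : ℕ} (hk : k ≠ 0)
    (z : ℂ) : pairFactor τ k z = 0 ↔ z = τ k ∨ z = τ (-k) := by
  have hfactor {j : ℤ} (hj : j ≠ 0) : 1 - z / τ j = 0 ↔ z = τ j := by
    rw [sub_eq_zero, eq_comm,
      div_eq_one_iff_eq (Complex.ofReal_ne_zero.2 (node_ne_zero hL hτ hj))]
  rw [pairFactor, mul_eq_zero, hfactor (by simpa using hk), hfactor (by simpa using hk)]

theorem G_eq_zero_iff (hL : L < 1) (hτ : ∀ k, |τ k - k| ≤ L) (z : ℂ) :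
    G τ z = 0 ↔ ∃ k : ℤ, z = τ k := by
  rw [G, mul_eq_zero, sub_eq_zero,
    tprod_eq_zero_iff_of_summable (summable_norm_pairFactor_sub_one hL hτ z)]
  simp_rw [pairFactor_eq_zero_iff hL hτ (Nat.succ_ne_zero _)]
  constructor
  · rintro (h | ⟨k, h | h⟩) <;> exact ⟨_, h⟩
  · rintro ⟨k, hk⟩
    obtain ⟨n, rfl | rfl⟩ := k.eq_nat_or_neg <;> cases n with
    | zero => exact Or.inl (by simpa using hk)
    | succ n => exact Or.inr ⟨n, by simp [hk]⟩

/-- The partial products of the canonical product `G τ`. -/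
def partialG (τ : ℤ → ℝ) (N : ℕ) (z : ℂ) : ℂ :=
  (z - τ 0) * ∏ k ∈ Finset.range N, pairFactor τ (k + 1) z

lemma tendsto_partialG (hL : L < 1) (hτ : ∀ k, |τ k - k| ≤ L) (z : ℂ) :
    Tendsto (fun N => partialG τ N z) atTop (𝓝 (G τ z)) :=
  (multipliable_pairFactor hL hτ z).hasProd.tendsto_prod_nat.const_mul _

lemma G_intCast (z : ℂ) : G (fun k : ℤ => k) z = Complex.sin (Real.pi * z) / Real.pi := by
  have hfactor (k : ℕ) : pairFactor (fun k : ℤ => k) (k + 1) z = 1 - z ^ 2 / ((k : ℂ) + 1) ^ 2 := by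
    have : (k : ℂ) + 1 ≠ 0 := k.cast_add_one_ne_zero
    rw [pairFactor]
    push_cast
    field_simp
    ring
  have hpartial (N : ℕ) : partialG (fun k : ℤ => k) N z =
      Real.pi * z * (∏ k ∈ Finset.range N, (1 - z ^ 2 / ((k : ℂ) + 1) ^ 2)) / Real.pi := by
    have : (Real.pi : ℂ) ≠ 0 := Complex.ofReal_ne_zero.2 Real.pi_ne_zero
    simp only [partialG, hfactor, Int.cast_zero, Complex.ofReal_zero, sub_zero]
    field_simp
  refine tendsto_nhds_unique (tendsto_partialG zero_lt_one (by simp) z) ?_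
  simp_rw [hpartial]
  exact (Complex.tendsto_euler_sin_prod z).div_const _

lemma exists_prod_Icc_sub_eq_mul_partialG (hL : L < 1) (hτ : ∀ k, |τ k - k| ≤ L) (N : ℕ) :
    ∃ ν : ℂ, ν ≠ 0 ∧ ∀ z : ℂ,
      ∏ k ∈ Finset.Icc (-(N : ℤ)) N, (z - τ k) = ν * partialG τ N z := by
  induction N with
  | zero => exact ⟨1, one_ne_zero, fun z => by simp [partialG]⟩
  | succ N ih =>
    obtain ⟨ν, hν, hprod⟩ := ih
    have hpos : (τ (N + 1 : ℕ) : ℂ) ≠ 0 :=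
      Complex.ofReal_ne_zero.2 (node_ne_zero hL hτ (by omega))
    have hneg : (τ (-(N + 1 : ℕ)) : ℂ) ≠ 0 :=
      Complex.ofReal_ne_zero.2 (node_ne_zero hL hτ (by omega))
    have hIcc : Finset.Icc (-((N + 1 : ℕ) : ℤ)) (N + 1 : ℕ) =
        insert ((N + 1 : ℕ) : ℤ) (insert (-((N + 1 : ℕ) : ℤ)) (Finset.Icc (-(N : ℤ)) N)) := by
      ext j
      simp only [Finset.mem_Icc, Finset.mem_insert]
      omega
    refine ⟨ν * (τ (N + 1 : ℕ) * τ (-(N + 1 : ℕ))), mul_ne_zero hν (mul_ne_zero hpos hneg),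
      fun z => ?_⟩
    rw [hIcc, Finset.prod_insert (by simp only [Finset.mem_insert, Finset.mem_Icc]; omega),
      Finset.prod_insert (by simp), hprod, partialG, partialG, Finset.prod_range_succ, pairFactor]
    field_simp
    ring

end CanonicalProduct

section Interpolation

open Polynomial

lemma sinc_pi_mul_sub_intCast {t : ℝ} {j : ℤ} (h : t ≠ j) :
    (Real.sinc (Real.pi * (t - j)) : ℂ) = (-1) ^ j * G (fun k : ℤ => k) t / (t - j) := by
  rw [Real.sinc_of_ne_zero (mul_ne_zero Real.pi_ne_zero (sub_ne_zero.2 h)), mul_sub,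
    mul_comm Real.pi (j : ℝ), Real.sin_sub_int_mul_pi, G_intCast, mul_div_assoc', div_div]
  push_cast
  ring_nf

/-- The functional on `L2Circle` whose value at `expVec t`, `t ∉ ℤ`, is the multiple of `P(t)` by
`sin (π t) / (π ∏ (t - j))`, the product running over `j ∈ S`: Lagrange interpolation of `P` at the
integers in `S`. -/
def interpFunctional (S : Finset ℤ) (P : ℂ[X]) : L2Circle →L[ℂ] ℂ :=
  ∑ j ∈ S, ((-1) ^ j * (Lagrange.nodalWeight S (fun i : ℤ => (i : ℂ)) j * P.eval (j : ℂ))) •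
    innerSL ℂ (expVec j)

lemma interpFunctional_expVec (S : Finset ℤ) (P : ℂ[X]) (t : ℝ) :
    interpFunctional S P (expVec t) =
      ∑ j ∈ S, (-1) ^ j * (Lagrange.nodalWeight S (fun i : ℤ => (i : ℂ)) j * P.eval (j : ℂ)) *
        (Real.sinc (Real.pi * (t - j)) : ℂ) := by
  simp only [interpFunctional, sum_apply, smul_apply, innerSL_apply_apply, inner_expVec,
    smul_eq_mul]

lemma interpFunctional_expVec_intCast (S : Finset ℤ) (P : ℂ[X]) (m : ℤ) :
    interpFunctional S P (expVec m) = if m ∈ S then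
      (-1) ^ m * (Lagrange.nodalWeight S (fun i : ℤ => (i : ℂ)) m * P.eval (m : ℂ)) else 0 := by
  have hsinc (j : ℤ) : Real.sinc (Real.pi * ((m : ℝ) - j)) = if m = j then 1 else 0 := by
    simp only [← Int.cast_sub, sinc_pi_mul_intCast, sub_eq_zero]
  simp only [interpFunctional_expVec, hsinc, apply_ite Complex.ofReal, Complex.ofReal_one,
    Complex.ofReal_zero, mul_ite, mul_one, mul_zero, Finset.sum_ite_eq]

lemma interpFunctional_expVec_mul_prod {S : Finset ℤ} {P : ℂ[X]} (hP : P.degree < S.card) {t : ℝ}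
    (ht : t ∉ Set.range ((↑) : ℤ → ℝ)) :
    interpFunctional S P (expVec t) * ∏ j ∈ S, ((t : ℂ) - j) =
      G (fun k : ℤ => k) t * P.eval (t : ℂ) := by
  have htj (j : ℤ) : (t : ℂ) ≠ j := fun h => ht ⟨j, by exact_mod_cast h.symm⟩
  have hinterp : P.eval (t : ℂ) = (Lagrange.nodal S fun i : ℤ => (i : ℂ)).eval (t : ℂ) *
      ∑ j ∈ S, Lagrange.nodalWeight S (fun i : ℤ => (i : ℂ)) j * ((t : ℂ) - j)⁻¹ *
        P.eval (j : ℂ) := by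
    rw [← Lagrange.eval_interpolate_not_at_node (fun i : ℤ => P.eval (i : ℂ)) fun j _ => htj j,
      ← Lagrange.eq_interpolate (fun i _ j _ h => Int.cast_injective h) hP]
  rw [hinterp, Lagrange.eval_nodal, interpFunctional_expVec, mul_left_comm, mul_comm]
  congr 1
  rw [Finset.mul_sum]
  refine Finset.sum_congr rfl fun j _ => ?_
  have hsign : ((-1 : ℂ) ^ j) * (-1) ^ j = 1 := by
    rw [← mul_zpow, neg_one_mul, neg_neg, one_zpow]
  rw [sinc_pi_mul_sub_intCast fun h => ht ⟨j, h.symm⟩]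
  linear_combination (Lagrange.nodalWeight S (fun i : ℤ => (i : ℂ)) j * P.eval (j : ℂ) *
    G (fun k : ℤ => k) t / (t - j)) * hsign

lemma interpFunctional_expVec_eq_zero {S : Finset ℤ} {P : ℂ[X]} (hP : P.degree < S.card) {t : ℝ}
    (ht : P.eval (t : ℂ) = 0) : interpFunctional S P (expVec t) = 0 := by
  by_cases hint : t ∈ Set.range ((↑) : ℤ → ℝ)
  · obtain ⟨m, rfl⟩ := hint
    rw [Complex.ofReal_intCast] at ht
    rw [interpFunctional_expVec_intCast, ht, mul_zero, mul_zero, ite_self]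
  · have hmul := interpFunctional_expVec_mul_prod hP hint
    rw [ht, mul_zero] at hmul
    refine (mul_eq_zero.1 hmul).resolve_right (Finset.prod_ne_zero_iff.2 fun j _ hj => ?_)
    exact hint ⟨j, by exact_mod_cast (sub_eq_zero.1 hj).symm⟩

end Interpolation

section Sampling

variable {τ : ℤ → ℝ} {L : ℝ} {T : L2Z ≃L[ℂ] L2Circle}

/-- The `k`-th coordinate of the exponential of frequency `t` in the basis `T (lp.single 2 j 1)`. -/
def coord (T : L2Z ≃L[ℂ] L2Circle) (k : ℤ) (t : ℝ) : ℂ := T.symm (expVec t) k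

lemma continuous_coord (T : L2Z ≃L[ℂ] L2Circle) (k : ℤ) : Continuous (coord T k) :=
  (lp.evalCLM ℂ (fun _ : ℤ => ℂ) 2 k).continuous.comp
    (T.symm.continuous.comp continuous_expVec)

lemma coord_node (hT : ∀ k, T (lp.single 2 k 1) = expVec (τ k)) (k : ℤ) :
    coord T k (τ k) = 1 := by
  rw [coord, ← hT, T.symm_apply_apply, lp.single_apply_self]

lemma apply_expVec_eq_mul_coord (hT : ∀ k, T (lp.single 2 k 1) = expVec (τ k)) {k : ℤ}
    {φ : L2Circle →L[ℂ] ℂ} (hφ : ∀ j ≠ k, φ (expVec (τ j)) = 0) (t : ℝ) :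
    φ (expVec t) = φ (expVec (τ k)) * coord T k t := by
  have hcomp : φ ∘L (T : L2Z →L[ℂ] L2Circle) =
      φ (expVec (τ k)) • lp.evalCLM ℂ (fun _ : ℤ => ℂ) 2 k := by
    refine ext_single ENNReal.ofNat_ne_top fun j => ?_
    change φ (T _) = φ (expVec (τ k)) * (lp.single 2 j (1 : ℂ) : L2Z) k
    rw [hT]
    rcases eq_or_ne j k with rfl | hjk
    · rw [lp.single_apply_self, mul_one]
    · rw [lp.single_apply_ne _ _ _ hjk.symm, mul_zero, hφ j hjk]
  have happly : φ (T (T.symm (expVec t))) = φ (expVec (τ k)) * coord T k t :=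
    DFunLike.congr_fun hcomp _
  rwa [T.apply_symm_apply] at happly

lemma tendsto_of_piecewise (hT : ∀ k, T (lp.single 2 k 1) = expVec (τ k))
    {V : Finset ℤ → L2Z ≃L[ℂ] L2Circle}
    (hV : ∀ S k, V S (lp.single 2 k 1) = expVec (S.piecewise τ (↑) k)) (x : L2Z) :
    Tendsto (fun S => V S x) atTop (𝓝 (T x)) := by
  set U := (synthesis.toContinuousLinearEquiv : L2Z →L[ℂ] L2Circle)
  have hVS (S : Finset ℤ) : (V S : L2Z →L[ℂ] L2Circle) =
      U - (U - (T : L2Z →L[ℂ] L2Circle)) ∘L truncation ℂ 2 S := by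
    refine ext_single ENNReal.ofNat_ne_top fun k => ?_
    change V S _ = synthesis _ - (U - (T : L2Z →L[ℂ] L2Circle)) (truncation ℂ 2 S _)
    rw [hV, truncation_single, synthesis_single]
    split_ifs with hk
    · change _ = _ - (synthesis _ - T _)
      rw [S.piecewise_eq_of_mem _ _ hk, synthesis_single, hT, sub_sub_cancel]
    · rw [S.piecewise_eq_of_notMem _ _ hk, map_zero, sub_zero]
  have hlim := (tendsto_const_nhds (x := U x)).sub
    (((U - (T : L2Z →L[ℂ] L2Circle)).continuous.tendsto x).comp
      (tendsto_truncation ENNReal.ofNat_ne_top x))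
  convert hlim using 2 with S
  · exact DFunLike.congr_fun (hVS S) x
  · exact (sub_sub_cancel (U x) (T x)).symm

lemma exists_piecewise_equiv (hL : L < 1 / 4) (hτ : ∀ k, |τ k - k| ≤ L)
    (hT : ∀ k, T (lp.single 2 k 1) = expVec (τ k)) :
    ∃ V : Finset ℤ → L2Z ≃L[ℂ] L2Circle,
      (∀ S k, V S (lp.single 2 k 1) = expVec (S.piecewise τ (↑) k)) ∧
      ∀ k t, Tendsto (fun S => coord (V S) k t) atTop (𝓝 (coord T k t)) := by
  have hL0 : 0 ≤ L := (abs_nonneg _).trans (hτ 0)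
  have hpiecewise (S : Finset ℤ) (k : ℤ) : |S.piecewise τ (↑) k - (k : ℝ)| ≤ L := by
    by_cases hk : k ∈ S
    · rw [S.piecewise_eq_of_mem _ _ hk]
      exact hτ k
    · rwa [S.piecewise_eq_of_notMem _ _ hk, sub_self, abs_zero]
  choose V hV hbound using fun S => exists_riesz_equiv hL (hpiecewise S)
  refine ⟨V, hV, fun k t => ?_⟩
  exact ((lp.evalCLM ℂ (fun _ : ℤ => ℂ) 2 k).continuous.tendsto _).comp
    (tendsto_symm_of_tendsto (sub_pos.2 (kadecConst_lt_one hL0 hL)) hbound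
      (tendsto_of_piecewise hT hV) (expVec t))

lemma exists_mul_coord_eq_of_piecewise (hL : L < 1) (hτ : ∀ k, |τ k - k| ≤ L) {N : ℕ}
    {V : L2Z ≃L[ℂ] L2Circle}
    (hV : ∀ k, V (lp.single 2 k 1) = expVec ((Finset.Icc (-(N : ℤ)) N).piecewise τ (↑) k))
    {k : ℤ} (hk : k ∈ Finset.Icc (-(N : ℤ)) N) :
    ∃ μ ν : ℂ, ν ≠ 0 ∧ ∀ t : ℝ, t ∉ Set.range ((↑) : ℤ → ℝ) →
      μ * (coord V k t * (t - τ k) * partialG (fun k : ℤ => k) N t) =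
        ν * (G (fun k : ℤ => k) t * partialG τ N t) := by
  obtain ⟨ν, hν, hprod⟩ := exists_prod_Icc_sub_eq_mul_partialG hL hτ N
  obtain ⟨ν', -, hprod'⟩ :=
    exists_prod_Icc_sub_eq_mul_partialG (τ := fun k : ℤ => k) zero_lt_one (by simp) N
  set S := Finset.Icc (-(N : ℤ)) N
  set P := Lagrange.nodal (S.erase k) fun j => (τ j : ℂ)
  have hdeg : P.degree < S.card := by
    rw [Lagrange.degree_nodal]
    exact_mod_cast Finset.card_erase_lt_of_mem hk
  have hzero (j : ℤ) (hj : j ≠ k) :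
      interpFunctional S P (expVec (S.piecewise τ (↑) j)) = 0 := by
    by_cases hjS : j ∈ S
    · rw [S.piecewise_eq_of_mem _ _ hjS]
      exact interpFunctional_expVec_eq_zero hdeg
        (Lagrange.eval_nodal_at_node (v := fun j => (τ j : ℂ)) (Finset.mem_erase.2 ⟨hj, hjS⟩))
    · rw [S.piecewise_eq_of_notMem _ _ hjS, interpFunctional_expVec_intCast, if_neg hjS]
  refine ⟨interpFunctional S P (expVec (S.piecewise τ (↑) k)) * ν', ν, hν, fun t ht => ?_⟩
  have hcoord := interpFunctional_expVec_mul_prod hdeg ht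
  have hint := hprod' t
  simp only [Complex.ofReal_intCast] at hint
  rw [apply_expVec_eq_mul_coord hV hzero, Lagrange.eval_nodal, hint] at hcoord
  have hnodes := hprod t
  rw [← Finset.mul_prod_erase _ _ hk] at hnodes
  linear_combination (t - τ k : ℂ) * hcoord + G (fun k : ℤ => k) t * hnodes

lemma coord_mul_sub_mul_G_comm (hL : L < 1 / 4) (hτ : ∀ k, |τ k - k| ≤ L)
    (hT : ∀ k, T (lp.single 2 k 1) = expVec (τ k)) (k : ℤ) {s t : ℝ}
    (hs : s ∉ Set.range ((↑) : ℤ → ℝ)) (ht : t ∉ Set.range ((↑) : ℤ → ℝ)) :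
    coord T k t * (t - τ k) * G τ s = coord T k s * (s - τ k) * G τ t := by
  have hL1 : L < 1 := hL.trans (by norm_num)
  obtain ⟨V, hV, hcoord⟩ := exists_piecewise_equiv hL hτ hT
  set I : ℕ → Finset ℤ := fun N => Finset.Icc (-(N : ℤ)) N
  have hside (r r' : ℝ) : Tendsto (fun N => coord (V (I N)) k r * (r - τ k) *
      partialG (fun k : ℤ => k) N r * (G (fun k : ℤ => k) r' * partialG τ N r')) atTop
      (𝓝 (coord T k r * (r - τ k) * G (fun k : ℤ => k) r * (G (fun k : ℤ => k) r' * G τ r'))) :=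
    ((((hcoord k r).comp Finset.tendsto_Icc_neg).mul_const _).mul
      (tendsto_partialG zero_lt_one (by simp) _)).mul ((tendsto_partialG hL1 hτ _).const_mul _)
  have hlim := tendsto_nhds_unique_of_eventuallyEq (hside t s) (hside s t) <| by
    filter_upwards [eventually_ge_atTop k.natAbs] with N hN
    have hk : k ∈ I N := by
      rw [Finset.mem_Icc]
      omega
    obtain ⟨μ, ν, hν, hμν⟩ := exists_mul_coord_eq_of_piecewise hL1 hτ (hV (I N)) hk
    refine mul_left_cancel₀ hν ?_
    linear_combination (coord (V (I N)) k s * (s - τ k) * partialG (fun k : ℤ => k) N s) *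
      hμν t ht - (coord (V (I N)) k t * (t - τ k) * partialG (fun k : ℤ => k) N t) * hμν s hs
  have hG (r : ℝ) (hr : r ∉ Set.range ((↑) : ℤ → ℝ)) : G (fun k : ℤ => k) r ≠ 0 := by
    rw [Ne, G_eq_zero_iff zero_lt_one (by simp)]
    rintro ⟨m, hm⟩
    exact hr ⟨m, by exact_mod_cast hm.symm⟩
  refine mul_right_cancel₀ (mul_ne_zero (hG t ht) (hG s hs)) ?_
  linear_combination hlim

lemma exists_coord_mul_sub_eq (hL : L < 1 / 4) (hτ : ∀ k, |τ k - k| ≤ L)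
    (hT : ∀ k, T (lp.single 2 k 1) = expVec (τ k)) (k : ℤ) :
    ∃ κ : ℂ, ∀ t, coord T k t * (t - τ k) = κ * G τ t := by
  have hL1 : L < 1 := hL.trans (by norm_num)
  obtain ⟨s, hs⟩ := (((Set.countable_range ((↑) : ℤ → ℝ)).union
    (Set.countable_range τ)).dense_compl ℝ).nonempty
  obtain ⟨hs_int, hs_node⟩ := not_or.1 hs
  have hGs : G τ s ≠ 0 := by
    rw [Ne, G_eq_zero_iff hL1 hτ]
    rintro ⟨j, hj⟩
    exact hs_node ⟨j, by exact_mod_cast hj.symm⟩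
  have hG : Continuous fun t : ℝ => G τ t :=
    (differentiable_G hL1 hτ).continuous.comp Complex.continuous_ofReal
  have hcoord := continuous_coord T k
  refine ⟨coord T k s * (s - τ k) / G τ s, congrFun <| Continuous.ext_on
    ((Set.countable_range ((↑) : ℤ → ℝ)).dense_compl ℝ) (by fun_prop) (by fun_prop) fun t ht => ?_⟩
  rw [div_mul_eq_mul_div, eq_div_iff hGs]
  exact coord_mul_sub_mul_G_comm hL hτ hT k hs_int ht

lemma mul_deriv_G_eq_one (hL : L < 1) (hτ : ∀ k, |τ k - k| ≤ L)
    (hT : ∀ k, T (lp.single 2 k 1) = expVec (τ k)) {k : ℤ} {κ : ℂ}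
    (hκ : ∀ t, coord T k t * (t - τ k) = κ * G τ t) : κ * deriv (G τ) (τ k) = 1 := by
  have hderiv : HasDerivAt (fun t : ℝ => κ * G τ t) (κ * deriv (G τ) (τ k)) (τ k) :=
    ((differentiable_G hL hτ (τ k)).hasDerivAt.comp_ofReal).const_mul κ
  refine hderiv.unique ?_
  rw [hasDerivAt_iff_tendsto_slope, ← coord_node hT k]
  refine (((continuous_coord T k).tendsto _).mono_left nhdsWithin_le_nhds).congr' ?_
  filter_upwards [self_mem_nhdsWithin] with t ht
  have hsub : (t : ℂ) - τ k ≠ 0 := sub_ne_zero.2 (Complex.ofReal_injective.ne ht)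
  rw [slope_def_module, ← hκ, ← hκ, sub_self, mul_zero, sub_zero, Complex.real_smul]
  push_cast
  field_simp

theorem deriv_G_ne_zero (hL : L < 1 / 4) (hτ : ∀ k, |τ k - k| ≤ L) (k : ℤ) :
    deriv (G τ) (τ k) ≠ 0 := by
  obtain ⟨T, hT, -⟩ := exists_riesz_equiv hL hτ
  obtain ⟨κ, hκ⟩ := exists_coord_mul_sub_eq hL hτ hT k
  exact right_ne_zero_of_mul_eq_one (mul_deriv_G_eq_one (hL.trans (by norm_num)) hτ hT hκ)

theorem coord_eq_samplingKernel (hL : L < 1 / 4) (hτ : ∀ k, |τ k - k| ≤ L)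
    (hT : ∀ k, T (lp.single 2 k 1) = expVec (τ k)) (k : ℤ) (t : ℝ) :
    coord T k t = samplingKernel τ k t := by
  rw [samplingKernel]
  split_ifs with ht
  · rw [ht, coord_node hT k]
  · obtain ⟨κ, hκ⟩ := exists_coord_mul_sub_eq hL hτ hT k
    have hκG := mul_deriv_G_eq_one (hL.trans (by norm_num)) hτ hT hκ
    rw [eq_div_iff (mul_ne_zero (deriv_G_ne_zero hL hτ k)
      (sub_ne_zero.2 (Complex.ofReal_injective.ne ht)))]
    linear_combination deriv (G τ) (τ k) * hκ t + G τ t * hκG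

lemma apply_truncation_symm_expVec (hT : ∀ k, T (lp.single 2 k 1) = expVec (τ k))
    (φ : L2Circle →L[ℂ] ℂ) (S : Finset ℤ) (t : ℝ) :
    φ (T (truncation ℂ 2 S (T.symm (expVec t)))) = ∑ k ∈ S, φ (expVec (τ k)) * coord T k t := by
  rw [truncation_eq_sum, map_sum, map_sum]
  refine Finset.sum_congr rfl fun k _ => ?_
  rw [single_eq_smul, map_smul, map_smul, hT, smul_eq_mul, mul_comm, coord]

theorem tendstoUniformlyOn_sum_samplingKernel (hL : L < 1 / 4) (hτ : ∀ k, |τ k - k| ≤ L)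
    (φ : L2Circle →L[ℂ] ℂ) {K : Set ℝ} (hK : IsCompact K) :
    TendstoUniformlyOn (fun (S : Finset ℤ) t => ∑ k ∈ S, φ (expVec (τ k)) * samplingKernel τ k t)
      (fun t => φ (expVec t)) atTop K := by
  obtain ⟨T, hT, -⟩ := exists_riesz_equiv hL hτ
  have htrunc := tendstoUniformlyOn_of_tendsto_of_norm_le
    (P := fun S : Finset ℤ => truncation ℂ 2 S) (Q := .id ℂ L2Z) norm_truncation_le
    (tendsto_truncation ENNReal.ofNat_ne_top) (T.symm.continuous.comp continuous_expVec) hK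
  have hφT := (φ ∘L (T : L2Z →L[ℂ] L2Circle)).uniformContinuous.comp_tendstoUniformlyOn htrunc
  refine (hφT.congr (.of_forall fun S t _ => ?_)).congr_right fun t _ => ?_
  · simp only [← coord_eq_samplingKernel hL hτ hT]
    exact apply_truncation_symm_expVec hT φ S t
  · exact congrArg φ (T.apply_symm_apply (expVec t))

end Sampling

end DiscreteHilbert

end

theorem theorem4p2 (a aStar : DiscreteHilbert.L2Z) (τ : ℤ → ℝ)
    (hτ : ∃ L : ℝ, L < 1 / 4 ∧ ∀ k : ℤ, |τ k - (k : ℝ)| ≤ L) :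
    -- the canonical product converges to an entire function with simple zeros at the `t_k`
    ((∀ z : ℂ, Multipliable fun k : ℕ => DiscreteHilbert.pairFactor τ (k + 1) z) ∧
      Differentiable ℂ (DiscreteHilbert.G τ) ∧
      (∀ z : ℂ, DiscreteHilbert.G τ z = 0 ↔ ∃ k : ℤ, z = (τ k : ℂ)) ∧
      ∀ k : ℤ, deriv (DiscreteHilbert.G τ) (τ k : ℂ) ≠ 0) ∧
    -- the sampling series converges to `Ψ`, uniformly on every compact subset of the line
    ∀ K : Set ℝ, IsCompact K →
      TendstoUniformlyOn
        (fun (s : Finset ℤ) (t : ℝ) =>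
          ∑ k ∈ s, DiscreteHilbert.Psi a aStar (τ k) * DiscreteHilbert.samplingKernel τ k t)
        (DiscreteHilbert.Psi a aStar) Filter.atTop K := by
  obtain ⟨L, hL, hτL⟩ := hτ
  have hL1 : L < 1 := hL.trans (by norm_num)
  refine ⟨⟨DiscreteHilbert.multipliable_pairFactor hL1 hτL,
    DiscreteHilbert.differentiable_G hL1 hτL, DiscreteHilbert.G_eq_zero_iff hL1 hτL,
    DiscreteHilbert.deriv_G_ne_zero hL hτL⟩, fun K hK => ?_⟩
  obtain ⟨φ, hφ⟩ := DiscreteHilbert.exists_Psi_eq_apply_expVec a aStar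
  simpa only [← hφ] using DiscreteHilbert.tendstoUniformlyOn_sum_samplingKernel hL hτL φ hK
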